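/- Let $\mathbb H$ be the Poincaré half-plane with boundary at infinity $\partial_\infty\mathbb H=\mathbb R\cup\{\infty\}$, and for $o\in\mathbb H$ give $\partial_\infty\mathbb H$ the Gromov–Bourdon visual distance $\rho_o(\xi,\eta)=\lim_{z\to\xi,\,w\to\eta}e^{-\langle z,w\rangle_o}$ (where $\langle z,w\rangle_o=\frac12(d(z,o)+d(o,w)-d(z,w))$), with respect to which the Hausdorff dimension $\mathrm{HD}$ is taken. For a discrete group $\Gamma$ of isometries of $\mathbb H$ let $\Lambda_\Gamma\subset\partial_\infty\mathbb H$ be its limit set, i.e. the set of points at infinity in the closure of the orbit $\Gamma\cdot o$ in $\mathbb H\cup\partial_\infty\mathbb H$, and let $\Lambda^\tau_\Gamma$ be its transient limit set: the set of $\xi\in\Lambda_\Gamma$ with $\lim_{t\to\infty}d(\xi_t,\Gamma\cdot o)=\infty$, where $\xi_t$ is the point at distance $t$ from $o$ on the geodesic ray $[o,\xi)$. For $j\ge 1$ put $x_j=2^{j^2}$, $r_j=2^{-j-2}$, $x_j'=\sqrt{x_j^2+r_j^2}$, and let $C_{j}$ and $C_{-j}$ be the Euclidean half-circles in $\mathbb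 H$ of radius $r_j$ centred at $x'_j$ and $-x'_j$. **Theorem.** There is an infinitely generated, torsion-free Fuchsian group $\Gamma$ (a discrete group of orientation-preserving isometries of $\mathbb H$ that is not finitely generated and in which only the identity has finite order) such that $$\mathrm{HD}(\Lambda^\tau_\Gamma)=0$$ for every base point $o$. Moreover $\Gamma$ can be taken to be generated by hyperbolic isometries $h_j$, $j\ge1$, where $h_j$ has fixed points $-x_j$ and $x_j$ at infinity and maps $C_{-j}$ onto $C_j$ and the exterior of $C_{-j}$ onto the interior of $C_j$; and for every $k\ge 1$ and every base point $o$ the subgroup $\Gamma_k$ generated by the $h_j$ with $j\ge k$ satisfies $\mathrm{HD}(\Lambda_{\Gamma_k})\le \frac1{2k}$. -/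

import Mathlib

open UpperHalfPlane Filter Topology
open scoped MatrixGroups ComplexConjugate ENNReal Pointwise

namespace Fuchsian

noncomputable section

/-! ### Isometries of the hyperbolic plane -/

/-- The isometry of the Poincaré half-plane `ℍ` given by the Möbius transformation of a matrix in
`SL(2, ℝ)`, as a group homomorphism. -/
def moebius : SL(2, ℝ) →* (ℍ ≃ᵢ ℍ) where
  toFun g := IsometryEquiv.constSMul g
  map_one' := by
    ext z : 1
    exact one_smul SL(2, ℝ) z
  map_mul' g g' := by
    ext z : 1
    exact mul_smul g g' z

/-- The group of orientation-preserving isometries of `ℍ`: the real Möbius transformations of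
positive determinant. -/
def isomPlus : Subgroup (ℍ ≃ᵢ ℍ) := moebius.range

/-- The compact-open topology on the isometry group of `ℍ`. -/
instance isometryTopology : TopologicalSpace (ℍ ≃ᵢ ℍ) :=
  TopologicalSpace.induced (fun f => (⟨f, f.continuous⟩ : C(ℍ, ℍ))) inferInstance

/-- A Fuchsian group: a discrete group of orientation-preserving isometries of `ℍ`. -/
def IsFuchsian (Γ : Subgroup (ℍ ≃ᵢ ℍ)) : Prop :=
  Γ ≤ isomPlus ∧ DiscreteTopology Γ

/-- A group of isometries without nontrivial elements of finite order. -/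
def IsTorsionFree (Γ : Subgroup (ℍ ≃ᵢ ℍ)) : Prop :=
  ∀ γ ∈ Γ, IsOfFinOrder γ → γ = 1

/-! ### The boundary at infinity

The boundary at infinity of `ℍ` is `ℝ ∪ {∞}`, that is `OnePoint ℝ`. For a point `o` of `ℍ`, the
Cayley transform `z ↦ (z - o) / (z - conj o)` identifies `ℍ` together with its boundary at infinity
with the closed unit disc, `o` being sent to the centre. -/

/-- The Cayley transform from `ℍ` to the unit disc which sends `o` to `0`. -/
def discMap (o z : ℍ) : ℂ := ((z : ℂ) - o) / ((z : ℂ) - conj (o : ℂ))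

/-- The extension of the Cayley transform to the boundary at infinity, with values in the unit
circle. -/
def bdryMap (o : ℍ) : OnePoint ℝ → ℂ
  | none => 1
  | some x => ((x : ℂ) - o) / ((x : ℂ) - conj (o : ℂ))

/-- The filter of neighbourhoods in `ℍ` of a point `ξ` at infinity, for the topology of
the compactification of `ℍ` by its boundary at infinity (the closed disc). -/
def nhdsInfty (o : ℍ) (ξ : OnePoint ℝ) : Filter ℍ := comap (discMap o) (𝓝 (bdryMap o ξ))

/-- The Gromov product at `o`. -/
def gromovProduct (o z w : ℍ) : ℝ := (dist z o + dist o w - dist z w) / 2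

/-- The Gromov-Bourdon visual distance on the boundary seen from `o`. It is half of the chordal
distance in the disc model centred at `o`; that this is `exp (-⟨ξ, η⟩_o)`, the Gromov product being
extended to the boundary by taking limits, is `tendsto_exp_neg_gromovProduct`. -/
def visualDist (o : ℍ) (ξ η : OnePoint ℝ) : ℝ := ‖bdryMap o ξ - bdryMap o η‖ / 2

/-- Hausdorff dimension of a set of points at infinity, with respect to the visual distance seen
from `o`: `bdryMap o` multiplies the visual distance by `2` (see `visualDist`). -/
def hausdorffDim (o : ℍ) (S : Set (OnePoint ℝ)) : ℝ≥0∞ := dimH (bdryMap o '' S)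

/-! ### Limit sets -/

/-- The orbit of `o`. -/
def orbit (Γ : Subgroup (ℍ ≃ᵢ ℍ)) (o : ℍ) : Set ℍ := {z | ∃ γ ∈ Γ, γ o = z}

/-- The limit set: the points at infinity in the closure of the orbit of `o`, taken in the
compactification of `ℍ` by its boundary at infinity. -/
def limitSet (Γ : Subgroup (ℍ ≃ᵢ ℍ)) (o : ℍ) : Set (OnePoint ℝ) :=
  {ξ | bdryMap o ξ ∈ closure (discMap o '' orbit Γ o)}

/-- `c` restricted to `[0, ∞)` is the (unit speed) geodesic ray from `o` to `ξ`. -/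
structure IsGeodesicRay (o : ℍ) (ξ : OnePoint ℝ) (c : ℝ → ℍ) : Prop where
  dist_eq : ∀ s t : ℝ, 0 ≤ s → 0 ≤ t → dist (c s) (c t) = |s - t|
  start : c 0 = o
  tendsto : Tendsto c atTop (nhdsInfty o ξ)

/-- The transient limit set: the limit points `ξ` such that the distance from `ξ_t` to the orbit
of `o` tends to infinity with `t`, where `ξ_t` is the point at distance `t` from `o` on the geodesic
ray from `o` to `ξ`. -/
def transientLimitSet (Γ : Subgroup (ℍ ≃ᵢ ℍ)) (o : ℍ) : Set (OnePoint ℝ) :=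
  {ξ | ξ ∈ limitSet Γ o ∧ ∃ c : ℝ → ℍ, IsGeodesicRay o ξ c ∧
    Tendsto (fun t => Metric.infDist (c t) (orbit Γ o)) atTop atTop}

/-! ### The half-circles -/

/-- The Euclidean half-circle in `ℍ` with centre `a` on the real axis and radius `r`. -/
def halfCircle (a r : ℝ) : Set ℍ := {z | ‖(z : ℂ) - a‖ = r}

/-- The interior of the half-circle. -/
def halfDisc (a r : ℝ) : Set ℍ := {z | ‖(z : ℂ) - a‖ < r}

/-- The exterior of the half-circle. -/
def halfCircleExt (a r : ℝ) : Set ℍ := {z | r < ‖(z : ℂ) - a‖}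

/-- The positive fixed point `x_j = 2 ^ (j ^ 2)`. -/
def fixPt (j : ℕ) : ℝ := 2 ^ (j ^ 2)

/-- The radius `r_j = 2 ^ (- j - 2)`. -/
def radius (j : ℕ) : ℝ := (2 ^ (j + 2))⁻¹

/-- The centre `√(x_j ^ 2 + r_j ^ 2)` of `C_j`; the centre of `C_{-j}` is its opposite. -/
def centre (j : ℕ) : ℝ := √(fixPt j ^ 2 + radius j ^ 2)

/-- `g` is a hyperbolic Möbius transformation with fixed points `-x_j` and `x_j` at infinity, which
pairs `C_{-j}` with `C_j`: it maps `C_{-j}` onto `C_j` and the exterior of `C_{-j}` onto the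
interior of `C_j`. -/
structure PairsHalfCircles (j : ℕ) (g : SL(2, ℝ)) : Prop where
  fixed : {ξ : OnePoint ℝ | (g : GL (Fin 2) ℝ) • ξ = ξ} =
    {((-fixPt j : ℝ) : OnePoint ℝ), (fixPt j : OnePoint ℝ)}
  circle : moebius g '' halfCircle (-centre j) (radius j) = halfCircle (centre j) (radius j)
  ext_int : moebius g '' halfCircleExt (-centre j) (radius j) = halfDisc (centre j) (radius j)

/-- The group of isometries generated by the `h j` with `j ≥ k`. -/
def tailGroup (h : ℕ → SL(2, ℝ)) (k : ℕ) : Subgroup (ℍ ≃ᵢ ℍ) :=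
  Subgroup.closure {f | ∃ j, k ≤ j ∧ f = moebius (h j)}

/-! ### The visual distance and the Gromov product -/

theorem sub_conj_ne_zero (o z : ℍ) : (z : ℂ) - conj (o : ℂ) ≠ 0 := by
  intro h
  have h1 := congrArg Complex.im h
  have h2 := z.im_pos
  have h3 := o.im_pos
  simp at h1
  linarith

theorem norm_discMap (o z : ℍ) : ‖discMap o z‖ = Real.tanh (dist z o / 2) := by
  rw [UpperHalfPlane.tanh_half_dist, discMap, norm_div, Complex.dist_eq, Complex.dist_eq]

theorem norm_bdryMap (o : ℍ) (ξ : OnePoint ℝ) : ‖bdryMap o ξ‖ = 1 := by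
  cases ξ with
  | infty => simp [bdryMap]
  | coe x =>
    have e : ((x : ℂ) - conj (o : ℂ)) = conj ((x : ℂ) - o) := by simp
    have h : (x : ℂ) - o ≠ 0 := by
      intro h
      have h1 := congrArg Complex.im h
      have h3 := o.im_pos
      simp at h1
      linarith
    change ‖((x : ℂ) - o) / ((x : ℂ) - conj (o : ℂ))‖ = 1
    rw [norm_div, e, Complex.norm_conj, div_self (norm_ne_zero_iff.2 h)]

theorem sinh_half_dist_eq (o z w : ℍ) : Real.sinh (dist z w / 2) =
    ‖discMap o z - discMap o w‖ * Real.cosh (dist z o / 2) * Real.cosh (dist w o / 2) := by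
  have hz := sub_conj_ne_zero o z
  have hw := sub_conj_ne_zero o w
  have e : discMap o z - discMap o w = ((z : ℂ) - w) * ((o : ℂ) - conj (o : ℂ)) /
      (((z : ℂ) - conj (o : ℂ)) * ((w : ℂ) - conj (o : ℂ))) := by
    rw [discMap, discMap, div_sub_div _ _ hz hw]
    congr 1
    ring
  have ho : ‖(o : ℂ) - conj (o : ℂ)‖ = 2 * o.im := by
    rw [Complex.sub_conj, norm_mul, Complex.norm_I, Complex.norm_real, mul_one, Real.norm_eq_abs,
      abs_of_pos (by have := o.im_pos; simpa using this)]
    rfl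
  have hz' := norm_ne_zero_iff.2 hz
  have hw' := norm_ne_zero_iff.2 hw
  have p1 := Real.sqrt_pos.2 z.im_pos
  have p2 := Real.sqrt_pos.2 w.im_pos
  have p3 := Real.sqrt_pos.2 o.im_pos
  rw [UpperHalfPlane.sinh_half_dist, UpperHalfPlane.cosh_half_dist, UpperHalfPlane.cosh_half_dist,
    e, norm_div, norm_mul, norm_mul, ho, Complex.dist_eq, Complex.dist_eq, Complex.dist_eq,
    Real.sqrt_mul z.im_pos.le, Real.sqrt_mul z.im_pos.le, Real.sqrt_mul w.im_pos.le]
  have h4 : o.im = √o.im * √o.im := (Real.mul_self_sqrt o.im_pos.le).symm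
  generalize √o.im = s at *
  rw [h4]
  field_simp

theorem exp_neg_gromovProduct (o z w : ℍ) : Real.exp (-gromovProduct o z w) =
    ‖discMap o z - discMap o w‖ / 2 * (1 + Real.exp (-dist z o)) * (1 + Real.exp (-dist w o)) +
      Real.exp (-dist z w / 2) * Real.exp (-dist z o / 2) * Real.exp (-dist w o / 2) := by
  have h := sinh_half_dist_eq o z w
  rw [Real.sinh_eq, Real.cosh_eq, Real.cosh_eq] at h
  have e1 : Real.exp (-gromovProduct o z w) =
      Real.exp (dist z w / 2) * Real.exp (-(dist z o / 2)) * Real.exp (-(dist w o / 2)) := by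
    rw [← Real.exp_add, ← Real.exp_add, gromovProduct, dist_comm o w]
    congr 1
    ring
  have e2 (a : ℝ) : Real.exp (-a) = Real.exp (-(a / 2)) * Real.exp (-(a / 2)) := by
    rw [← Real.exp_add]
    congr 1
    ring
  have e3 (a : ℝ) : Real.exp (a / 2) * Real.exp (-(a / 2)) = 1 := by
    rw [← Real.exp_add, add_neg_cancel, Real.exp_zero]
  rw [e1, e2 (dist z o), e2 (dist w o), neg_div, neg_div, neg_div]
  have hz := e3 (dist z o)
  have hw := e3 (dist w o)
  generalize Real.exp (-(dist z o / 2)) = a at *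
  generalize Real.exp (-(dist w o / 2)) = b at *
  generalize Real.exp (dist z o / 2) = a' at *
  generalize Real.exp (dist w o / 2) = b' at *
  generalize Real.exp (dist z w / 2) = c at *
  generalize Real.exp (-(dist z w / 2)) = c' at *
  generalize ‖discMap o z - discMap o w‖ = n at *
  linear_combination (2 * a * b) * h + (n / 2 * (b' * b + b * b) + 0) * hz +
    (n / 2 * (1 + a * a)) * hw

theorem tendsto_exp_neg_dist (o : ℍ) (ξ : OnePoint ℝ) :
    Tendsto (fun z => Real.exp (-dist z o)) (nhdsInfty o ξ) (𝓝 0) := by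
  have h : ∀ z : ℍ, Real.exp (-dist z o) = (1 - ‖discMap o z‖) / (1 + ‖discMap o z‖) := by
    intro z
    have e2 (a : ℝ) : Real.exp (-a) = Real.exp (-(a / 2)) * Real.exp (-(a / 2)) := by
      rw [← Real.exp_add]
      congr 1
      ring
    have e3 : Real.exp (dist z o / 2) * Real.exp (-(dist z o / 2)) = 1 := by
      rw [← Real.exp_add, add_neg_cancel, Real.exp_zero]
    rw [norm_discMap, Real.tanh_eq_sinh_div_cosh, Real.sinh_eq, Real.cosh_eq, e2]
    have p1 := Real.exp_pos (dist z o / 2)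
    have p2 := Real.exp_pos (-(dist z o / 2))
    generalize Real.exp (dist z o / 2) = a at *
    generalize Real.exp (-(dist z o / 2)) = b at *
    have hb : b = a⁻¹ := eq_inv_of_mul_eq_one_right e3
    have q : (a - b) / 2 / ((a + b) / 2) = (a - b) / (a + b) := by field_simp
    have q1 : (1 - (a - b) / (a + b)) = 2 * b / (a + b) := by field_simp; ring
    have q2 : (1 + (a - b) / (a + b)) = 2 * a / (a + b) := by field_simp; ring
    rw [q, q1, q2, div_div_div_cancel_right₀ (by positivity), eq_div_iff (by positivity)]
    linear_combination (2 * b) * e3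
  simp_rw [h]
  have ht : Tendsto (fun z => ‖discMap o z‖) (nhdsInfty o ξ) (𝓝 1) := by
    rw [← norm_bdryMap o ξ]
    exact tendsto_comap.norm
  have := (ht.const_sub 1).div (ht.const_add 1) (by norm_num)
  rw [sub_self, zero_div] at this
  exact this

/-- The visual distance is the limit of `exp (-⟨z, w⟩_o)` as `z → ξ` and `w → η`. -/
theorem tendsto_exp_neg_gromovProduct (o : ℍ) (ξ η : OnePoint ℝ) :
    Tendsto (fun p : ℍ × ℍ => Real.exp (-gromovProduct o p.1 p.2))
      (nhdsInfty o ξ ×ˢ nhdsInfty o η) (𝓝 (visualDist o ξ η)) := by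
  simp_rw [exp_neg_gromovProduct]
  have h1 : Tendsto (fun p : ℍ × ℍ => Real.exp (-dist p.1 o)) (nhdsInfty o ξ ×ˢ nhdsInfty o η)
      (𝓝 0) := (tendsto_exp_neg_dist o ξ).comp tendsto_fst
  have h2 : Tendsto (fun p : ℍ × ℍ => Real.exp (-dist p.2 o)) (nhdsInfty o ξ ×ˢ nhdsInfty o η)
      (𝓝 0) := (tendsto_exp_neg_dist o η).comp tendsto_snd
  have h3 : Tendsto (fun p : ℍ × ℍ => ‖discMap o p.1 - discMap o p.2‖)
      (nhdsInfty o ξ ×ˢ nhdsInfty o η) (𝓝 ‖bdryMap o ξ - bdryMap o η‖) :=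
    ((tendsto_comap.comp tendsto_fst).sub (tendsto_comap.comp tendsto_snd)).norm
  have h4 : Tendsto (fun p : ℍ × ℍ => Real.exp (-dist p.1 p.2 / 2) * Real.exp (-dist p.1 o / 2) *
      Real.exp (-dist p.2 o / 2)) (nhdsInfty o ξ ×ˢ nhdsInfty o η) (𝓝 0) := by
    refine squeeze_zero (fun p => by positivity) (fun p => ?_) h1
    rw [← Real.exp_add, ← Real.exp_add]
    apply Real.exp_le_exp.2
    have := dist_triangle p.1 p.2 o
    linarith
  have := (((h3.div_const 2).mul (h1.const_add 1)).mul (h2.const_add 1)).add h4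
  simpa [visualDist] using this

end

end Fuchsian

/-!
Enlarge the half-circles so little that they stay far apart, and the generators play ping-pong with
the discs which they bound. So `Γ` is free and discrete, and all but countably many limit points are
coded by infinite reduced words. A letter contracts, by the factor `(3 r / c) ^ 2`, a set containing
the discs of all the letters which may follow it. If the `s`-th powers of these factors add up to at
most `1`, for the letters which occur from some place on, then covering by the images of the discs
shows that the points so coded form a set of dimension at most `s`.

Let `γ n` be the product of the first `n` letters of a word, `a` the `n`-th letter and `ξ` the coded
point. Seen from `(γ n)⁻¹`, the base point lies in the disc of `a⁻¹` and the end of the ray in that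
of the next letter, so the geodesic ray to `ξ` passes within a bounded multiple of the centre of `a`
from the orbit. On a transient ray no letter therefore recurs infinitely often. From some place on
the word avoids any given finite set of letters, and the remaining ones make the sum as small as we
like, for every `s > 0`.
-/

namespace Fuchsian

noncomputable section

/-! ### Contractions between discs -/

section Letters

variable {ι : Type*} {a b : ι × Bool}

/-- The inverse of a letter, for letters written as in `FreeGroup`. -/
def invLetter (a : ι × Bool) : ι × Bool := (a.1, !a.2)

/-- The relation between consecutive letters of a reduced word, as in
`FreeGroup.isReduced_cons_cons`. -/
def NonCancelling (a b : ι × Bool) : Prop := a.1 = b.1 → a.2 = b.2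

@[simp] theorem invLetter_fst (a : ι × Bool) : (invLetter a).1 = a.1 := rfl

@[simp] theorem invLetter_invLetter (a : ι × Bool) : invLetter (invLetter a) = a := by
  simp [invLetter]

theorem NonCancelling.symm (h : NonCancelling a b) : NonCancelling b a := fun e => (h e.symm).symm

theorem NonCancelling.invLetter (h : NonCancelling a b) :
    NonCancelling (invLetter a) (invLetter b) := fun e => congrArg not (h e)

theorem NonCancelling.eq_of_fst_eq (h : NonCancelling a b) (e : a.1 = b.1) : a = b :=
  Prod.ext e (h e)

theorem nonCancelling_invLetter_of_ne (h : a ≠ b) : NonCancelling a (invLetter b) :=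
  fun e => Bool.eq_not.2 fun e' => h (Prod.ext e e')

end Letters

/-- Pairs of half-circles of radius `radius i` around `± centre i`, so far apart that the Möbius
transformations `z ↦ c - r ^ 2 / (z + c)` pairing them contract the discs which they play ping-pong
with. The numerical constants are chosen to suit the half-circles of the theorem. -/
structure SchottkySystem (ι : Type*) where
  centre : ι → ℝ
  radius : ι → ℝ
  one_le_centre : ∀ i, 1 ≤ centre i
  radius_pos : ∀ i, 0 < radius i
  radius_le : ∀ i, radius i ≤ 1 / 4
  separated : ∀ i j, i ≠ j → max (centre i) (centre j) / 3 + 1 / 4 ≤ |centre i - centre j|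

namespace SchottkySystem

variable {ι : Type*} (D : SchottkySystem ι)

/-- The subfamily indexed by the image of an embedding. -/
def comap {κ : Type*} (e : κ ↪ ι) : SchottkySystem κ where
  centre := D.centre ∘ e
  radius := D.radius ∘ e
  one_le_centre _ := D.one_le_centre _
  radius_pos _ := D.radius_pos _
  radius_le _ := D.radius_le _
  separated _ _ h := D.separated _ _ (e.injective.ne h)

theorem centre_pos (i : ι) : 0 < D.centre i := one_pos.trans_le (D.one_le_centre i)

/-- The centre of the half-circle into which a letter maps the exterior of the opposite one. -/
def signedCentre (a : ι × Bool) : ℝ := cond a.2 (D.centre a.1) (-D.centre a.1)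

@[simp] theorem signedCentre_invLetter (a : ι × Bool) :
    D.signedCentre (invLetter a) = -D.signedCentre a := by
  rcases a with ⟨i, _ | _⟩ <;> simp [signedCentre, invLetter]

theorem abs_signedCentre (a : ι × Bool) : |D.signedCentre a| = D.centre a.1 := by
  rcases a with ⟨i, _ | _⟩ <;> simp [signedCentre, abs_of_pos (D.centre_pos i)]

theorem max_centre_div_three_add_le {a b : ι × Bool} (h : NonCancelling a b) :
    max (D.centre a.1) (D.centre b.1) / 3 + 1 / 4 ≤ |D.signedCentre a + D.signedCentre b| := by
  by_cases e : a.1 = b.1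
  · obtain rfl := h.eq_of_fst_eq e
    rw [max_self, ← two_mul, abs_mul, abs_two, abs_signedCentre]
    linarith [D.one_le_centre a.1]
  · calc _ ≤ |D.centre a.1 - D.centre b.1| := D.separated _ _ e
      _ = |(|D.signedCentre a| - |-D.signedCentre b|)| := by
        rw [abs_neg, abs_signedCentre, abs_signedCentre]
      _ ≤ |D.signedCentre a - -D.signedCentre b| := abs_abs_sub_abs_le _ _
      _ = _ := by rw [sub_neg_eq_add]

/-- The disc of a letter, bounded by the circle around `signedCentre`. -/
def disc (a : ι × Bool) : Set ℂ := Metric.closedBall (D.signedCentre a : ℂ) (D.radius a.1)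

variable {D} in
theorem mem_disc {a : ι × Bool} {z : ℂ} :
    z ∈ D.disc a ↔ ‖z - D.signedCentre a‖ ≤ D.radius a.1 := mem_closedBall_iff_norm

/-- The Möbius transformation of a letter, on the complex plane. -/
def letterMap (a : ι × Bool) (z : ℂ) : ℂ :=
  D.signedCentre a - D.radius a.1 ^ 2 / (z + D.signedCentre a)

/-- A neighbourhood of infinity on which the Möbius transformation of a letter is a contraction;
it contains the discs of all the letters which may follow. -/
def domain (a : ι × Bool) : Set ℂ := {z | D.centre a.1 / 3 ≤ ‖z + D.signedCentre a‖}

/-- The Lipschitz constant of a letter on its domain. -/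
def ratio (i : ι) : NNReal := ⟨(3 * D.radius i / D.centre i) ^ 2, sq_nonneg _⟩

theorem coe_ratio (i : ι) : (D.ratio i : ℝ) = (3 * D.radius i / D.centre i) ^ 2 := rfl

theorem ratio_le_mul_radius (i : ι) : (D.ratio i : ℝ) ≤ 9 / 4 * D.radius i := by
  have hr := D.radius_pos i
  have hc := D.one_le_centre i
  calc (3 * D.radius i / D.centre i) ^ 2 ≤ (3 * D.radius i) ^ 2 := by
        gcongr
        exact div_le_self (by positivity) hc
    _ ≤ 9 / 4 * D.radius i := by nlinarith [D.radius_le i]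

theorem ratio_le (i : ι) : D.ratio i ≤ 9 / 16 := by
  rw [← NNReal.coe_le_coe]
  push_cast
  linarith [D.ratio_le_mul_radius i, D.radius_le i]

theorem max_centre_div_three_le {a b : ι × Bool} (h : NonCancelling a b) {z : ℂ}
    (hz : z ∈ D.disc b) :
    max (D.centre a.1) (D.centre b.1) / 3 ≤ ‖z + D.signedCentre a‖ := by
  have h_triangle : |D.signedCentre a + D.signedCentre b| ≤
      ‖z + D.signedCentre a‖ + ‖z - D.signedCentre b‖ := by
    rw [← Real.norm_eq_abs, ← Complex.norm_real]
    calc _ = ‖(z + D.signedCentre a) - (z - D.signedCentre b)‖ := by push_cast; congr 1; ring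
      _ ≤ _ := norm_sub_le _ _
  linarith [D.max_centre_div_three_add_le h, mem_disc.1 hz, D.radius_le b.1]

theorem disc_subset_domain {a b : ι × Bool} (h : NonCancelling a b) : D.disc b ⊆ D.domain a :=
  fun _ hz => (div_le_div_of_nonneg_right (le_max_left _ _) (by norm_num)).trans
    (D.max_centre_div_three_le h hz)

theorem centre_le_norm_I_add (a : ι × Bool) : D.centre a.1 ≤ ‖Complex.I + D.signedCentre a‖ := by
  simpa [abs_signedCentre] using Complex.abs_re_le_norm (Complex.I + D.signedCentre a)

theorem I_mem_domain (a : ι × Bool) : Complex.I ∈ D.domain a :=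
  (div_le_self (D.centre_pos a.1).le (by norm_num)).trans (D.centre_le_norm_I_add a)

theorem add_signedCentre_ne_zero {a : ι × Bool} {z : ℂ} (hz : z ∈ D.domain a) :
    z + D.signedCentre a ≠ 0 :=
  norm_pos_iff.1 ((div_pos (D.centre_pos a.1) three_pos).trans_le hz)

theorem letterMap_sub_letterMap {a : ι × Bool} {z w : ℂ} (hz : z + D.signedCentre a ≠ 0)
    (hw : w + D.signedCentre a ≠ 0) : D.letterMap a z - D.letterMap a w =
      D.radius a.1 ^ 2 * (z - w) / ((z + D.signedCentre a) * (w + D.signedCentre a)) := by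
  simp only [letterMap]
  field_simp
  ring

theorem norm_letterMap_sub (a : ι × Bool) (z : ℂ) :
    ‖D.letterMap a z - D.signedCentre a‖ = D.radius a.1 ^ 2 / ‖z + D.signedCentre a‖ := by
  rw [letterMap, sub_sub_cancel_left, norm_neg, norm_div, norm_pow, Complex.norm_real,
    Real.norm_of_nonneg (D.radius_pos _).le]

theorem lipschitzOnWith_letterMap (a : ι × Bool) :
    LipschitzOnWith (D.ratio a.1) (D.letterMap a) (D.domain a) := by
  refine LipschitzOnWith.of_dist_le_mul fun z hz w hw => ?_
  have hc := D.centre_pos a.1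
  have hz' := norm_pos_iff.2 (D.add_signedCentre_ne_zero hz)
  have hw' := norm_pos_iff.2 (D.add_signedCentre_ne_zero hw)
  rw [Complex.dist_eq, Complex.dist_eq, D.letterMap_sub_letterMap (D.add_signedCentre_ne_zero hz)
    (D.add_signedCentre_ne_zero hw), norm_div, norm_mul, norm_mul, norm_pow, Complex.norm_real,
    Real.norm_of_nonneg (D.radius_pos _).le, coe_ratio, div_le_iff₀ (mul_pos hz' hw')]
  calc D.radius a.1 ^ 2 * ‖z - w‖
      = (3 * D.radius a.1 / D.centre a.1) ^ 2 * ‖z - w‖ *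
        (D.centre a.1 / 3 * (D.centre a.1 / 3)) := by field_simp
    _ ≤ _ := by gcongr <;> assumption

theorem mapsTo_letterMap_ball (a : ι × Bool) : Set.MapsTo (D.letterMap a) (D.domain a)
    (Metric.ball (D.signedCentre a : ℂ) (D.radius a.1)) := by
  intro z hz
  have hr := D.radius_pos a.1
  have hz' : D.radius a.1 < ‖z + D.signedCentre a‖ := by
    have : D.centre a.1 / 3 ≤ ‖z + D.signedCentre a‖ := hz
    linarith [D.radius_le a.1, D.one_le_centre a.1]
  rw [mem_ball_iff_norm, norm_letterMap_sub, div_lt_iff₀ (hr.trans hz'), sq]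
  gcongr

theorem mapsTo_letterMap (a : ι × Bool) :
    Set.MapsTo (D.letterMap a) (D.domain a) (D.disc a) :=
  (D.mapsTo_letterMap_ball a).mono_right Metric.ball_subset_closedBall

theorem letterMap_letterMap_invLetter (a : ι × Bool) {z : ℂ} (hz : z ≠ D.signedCentre a) :
    D.letterMap a (D.letterMap (invLetter a) z) = z := by
  have := sub_ne_zero.2 hz
  have hr : (D.radius a.1 : ℂ) ≠ 0 := by exact_mod_cast (D.radius_pos a.1).ne'
  have h_cancel : -(D.signedCentre a : ℂ) - D.radius a.1 ^ 2 / (z - D.signedCentre a) +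
      D.signedCentre a = -(D.radius a.1 ^ 2 / (z - D.signedCentre a)) := by ring
  simp only [letterMap, signedCentre_invLetter, invLetter_fst, Complex.ofReal_neg,
    ← sub_eq_add_neg, h_cancel]
  field_simp
  ring

end SchottkySystem

/-! ### Schottky groups -/

section Isometries

theorem continuous_isometry_apply (z : ℍ) : Continuous fun f : ℍ ≃ᵢ ℍ => f z :=
  (continuous_eval_const (F := C(ℍ, ℍ)) z).comp
    (continuous_induced_dom (f := fun f : ℍ ≃ᵢ ℍ => (⟨f, f.continuous⟩ : C(ℍ, ℍ))))

theorem discreteTopology_of_forall_mem_imp_eq_one {Γ : Subgroup (ℍ ≃ᵢ ℍ)} {z : ℍ} {U : Set ℍ}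
    (hU : IsOpen U) (hz : z ∈ U) (h : ∀ γ ∈ Γ, γ z ∈ U → γ = 1) : DiscreteTopology Γ := by
  rw [discreteTopology_iff_isOpen_singleton]
  intro γ
  have h_preimage :
      (fun g : Γ => (g : ℍ ≃ᵢ ℍ) z) ⁻¹' ((γ : ℍ ≃ᵢ ℍ) '' U) = {γ} := by
    refine Set.eq_singleton_iff_unique_mem.2 ⟨⟨z, hz, rfl⟩, ?_⟩
    rintro g ⟨w, hw, e⟩
    have h_apply : ((γ : ℍ ≃ᵢ ℍ)⁻¹ * g) z = w := (γ : ℍ ≃ᵢ ℍ).symm_apply_eq.2 e.symm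
    have h_one := h _ (mul_mem (inv_mem γ.2) g.2) (h_apply.symm ▸ hw)
    exact (Subtype.ext (inv_mul_eq_one.1 h_one)).symm
  rw [← h_preimage]
  exact ((γ : ℍ ≃ᵢ ℍ).toHomeomorph.isOpenMap U hU).preimage
    ((continuous_isometry_apply z).comp continuous_subtype_val)

theorem isTorsionFree_range {F : Type*} [Group F] [IsMulTorsionFree F] {f : F →* ℍ ≃ᵢ ℍ}
    (hf : Function.Injective f) : IsTorsionFree f.range := by
  rintro _ ⟨x, rfl⟩ hfin
  rw [(isOfFinOrder_iff_eq_one x).1 (hf.isOfFinOrder_iff.1 hfin), map_one]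

end Isometries

theorem not_fg_freeGroup (α : Type*) [Infinite α] : ¬ Group.FG (FreeGroup α) := by
  intro h
  have h_abelianization : AddGroup.FG (FreeAbelianGroup α) :=
    AddGroup.fg_iff_mul_fg.2 (Group.fg_of_surjective (G := FreeGroup α)
      (f := Abelianization.of) (QuotientGroup.mk'_surjective _))
  have h_finsupp : AddGroup.FG (α →₀ ℤ) :=
    AddGroup.fg_of_surjective (FreeAbelianGroup.equivFinsupp α).surjective
  rw [← Module.Finite.iff_addGroup_fg, Module.finite_finsupp_self_iff] at h_finsupp
  exact h_finsupp.elim (fun _ => not_subsingleton ℤ inferInstance) fun _ => not_finite α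

theorem coe_add_ofReal_ne_zero (z : ℍ) (x : ℝ) : (z : ℂ) + x ≠ 0 := fun h => by
  simpa [z.im_ne_zero] using congrArg Complex.im h

theorem coe_ne_ofReal (z : ℍ) (x : ℝ) : (z : ℂ) ≠ x := fun h => by
  simpa [z.im_ne_zero] using congrArg Complex.im h

namespace SchottkySystem

variable {ι : Type*} (D : SchottkySystem ι)

/-- The matrix of `z ↦ c - r ^ 2 / (z + c)`, where `c` is the centre and `r` the radius. -/
def matrix (i : ι) : SL(2, ℝ) :=
  ⟨(D.radius i)⁻¹ • !![D.centre i, D.centre i ^ 2 - D.radius i ^ 2; 1, D.centre i], by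
    have hr := (D.radius_pos i).ne'
    rw [Matrix.det_smul, Matrix.det_fin_two_of, Fintype.card_fin]
    field_simp
    ring⟩

/-- The isometry which pairs the half-circle around `-centre i` with that around `centre i`. -/
def generator (i : ι) : ℍ ≃ᵢ ℍ := moebius (D.matrix i)

/-- The Schottky group generated by the pairings of the half-circles. -/
def group : Subgroup (ℍ ≃ᵢ ℍ) := Subgroup.closure (Set.range D.generator)

/-- The isometry of a letter. -/
def letterIsom (a : ι × Bool) : ℍ ≃ᵢ ℍ := cond a.2 (D.generator a.1) (D.generator a.1)⁻¹

/-- The isometry of a word. -/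
def wordIsom (L : List (ι × Bool)) : ℍ ≃ᵢ ℍ := (L.map D.letterIsom).prod

theorem coe_generator (i : ι) (z : ℍ) : (D.generator i z : ℂ) = D.letterMap (i, true) z := by
  have h_smul : D.generator i z = D.matrix i • z := rfl
  have hz := coe_add_ofReal_ne_zero z (D.centre i)
  have hr : (D.radius i : ℂ) ≠ 0 := by exact_mod_cast (D.radius_pos i).ne'
  rw [h_smul, UpperHalfPlane.coe_specialLinearGroup_apply]
  simp only [matrix, Matrix.smul_of, Matrix.smul_cons, smul_eq_mul, mul_one, Matrix.of_apply,
    Matrix.cons_val', Matrix.cons_val_zero, Matrix.cons_val_one, Matrix.cons_val_fin_one,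
    Matrix.smul_empty, Algebra.algebraMap_self, Real.ringHom_apply,
    Complex.ofReal_mul, Complex.ofReal_inv, Complex.ofReal_sub, Complex.ofReal_pow, map_inv₀,
    letterMap, signedCentre, cond_true]
  field_simp
  ring

theorem coe_letterIsom (a : ι × Bool) (z : ℍ) : (D.letterIsom a z : ℂ) = D.letterMap a z := by
  rcases a with ⟨i, _ | _⟩
  · obtain ⟨w, rfl⟩ := (D.generator i).surjective z
    have h_inv : D.letterIsom (i, false) (D.generator i w) = w :=
      (D.generator i).symm_apply_apply w
    rw [h_inv, coe_generator]
    exact (D.letterMap_letterMap_invLetter (i, false) (coe_ne_ofReal w _)).symm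
  · exact D.coe_generator i z

@[simp] theorem wordIsom_nil : D.wordIsom [] = 1 := rfl

@[simp] theorem wordIsom_cons (a : ι × Bool) (L : List (ι × Bool)) :
    D.wordIsom (a :: L) = D.letterIsom a * D.wordIsom L := List.prod_cons

theorem coe_wordIsom_cons (a : ι × Bool) (L : List (ι × Bool)) (z : ℍ) :
    (D.wordIsom (a :: L) z : ℂ) = D.letterMap a (D.wordIsom L z) := by
  rw [wordIsom_cons, ← coe_letterIsom]
  rfl

theorem wordIsom_I_mem_disc {a : ι × Bool} {L : List (ι × Bool)}
    (h : FreeGroup.IsReduced (a :: L)) : (D.wordIsom (a :: L) I : ℂ) ∈ D.disc a := by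
  rw [coe_wordIsom_cons]
  apply D.mapsTo_letterMap
  cases L with
  | nil => exact D.I_mem_domain a
  | cons b L =>
    rw [FreeGroup.isReduced_cons_cons] at h
    exact D.disc_subset_domain h.1 (wordIsom_I_mem_disc h.2)

theorem three_div_four_le_norm_sub_I {a : ι × Bool} {z : ℂ} (hz : z ∈ D.disc a) :
    3 / 4 ≤ ‖z - Complex.I‖ := by
  have h_im : 1 ≤ ‖Complex.I - D.signedCentre a‖ := by
    simpa using Complex.abs_im_le_norm (Complex.I - D.signedCentre a)
  have h_triangle := norm_sub_le (z - D.signedCentre a) (z - Complex.I)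
  rw [sub_sub_sub_cancel_left] at h_triangle
  linarith [mem_disc.1 hz, D.radius_le a.1]

theorem eq_nil_of_norm_wordIsom_I_sub_lt {L : List (ι × Bool)} (h : FreeGroup.IsReduced L)
    (h_near : ‖(D.wordIsom L I : ℂ) - Complex.I‖ < 3 / 4) : L = [] := by
  cases L with
  | nil => rfl
  | cons a L =>
    exact absurd h_near (D.three_div_four_le_norm_sub_I (D.wordIsom_I_mem_disc h)).not_gt

theorem lift_generator_mk (L : List (ι × Bool)) :
    FreeGroup.lift D.generator (FreeGroup.mk L) = D.wordIsom L := FreeGroup.lift_mk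

theorem range_lift_generator : (FreeGroup.lift D.generator).range = D.group :=
  FreeGroup.range_lift_eq_closure

theorem wordIsom_mem_group (L : List (ι × Bool)) : D.wordIsom L ∈ D.group := by
  rw [← range_lift_generator, ← lift_generator_mk]
  exact ⟨_, rfl⟩

theorem exists_isReduced_of_mem_group {γ : ℍ ≃ᵢ ℍ} (h : γ ∈ D.group) :
    ∃ L, FreeGroup.IsReduced L ∧ D.wordIsom L = γ := by
  classical
  rw [← range_lift_generator] at h
  obtain ⟨x, rfl⟩ := h
  exact ⟨x.toWord, FreeGroup.isReduced_toWord, by rw [← lift_generator_mk, FreeGroup.mk_toWord]⟩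

theorem injective_lift_generator : Function.Injective (FreeGroup.lift D.generator) := by
  classical
  rw [injective_iff_map_eq_one]
  intro x hx
  rw [← FreeGroup.mk_toWord (x := x), lift_generator_mk] at hx
  refine FreeGroup.toWord_eq_nil_iff.1
    (D.eq_nil_of_norm_wordIsom_I_sub_lt FreeGroup.isReduced_toWord ?_)
  rw [hx]
  norm_num

theorem group_le_isomPlus : D.group ≤ isomPlus := by
  refine (Subgroup.closure_le _).2 ?_
  rintro _ ⟨i, rfl⟩
  exact ⟨D.matrix i, rfl⟩

theorem isFuchsian_group : IsFuchsian D.group := by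
  refine ⟨D.group_le_isomPlus, discreteTopology_of_forall_mem_imp_eq_one
    (U := {z : ℍ | ‖(z : ℂ) - Complex.I‖ < 3 / 4}) (z := I) ?_ (by simp) fun γ hγ h_near => ?_⟩
  · exact isOpen_lt (by fun_prop) continuous_const
  · obtain ⟨L, hL, rfl⟩ := D.exists_isReduced_of_mem_group hγ
    rw [D.eq_nil_of_norm_wordIsom_I_sub_lt hL h_near, wordIsom_nil]

theorem isTorsionFree_group : IsTorsionFree D.group :=
  D.range_lift_generator ▸ isTorsionFree_range D.injective_lift_generator

theorem not_fg_group [Infinite ι] : ¬ D.group.FG := by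
  rw [← range_lift_generator, ← Group.fg_iff_subgroup_fg]
  intro h
  exact not_fg_freeGroup ι (Group.fg_of_surjective
    (f := (MonoidHom.ofInjective D.injective_lift_generator).symm.toMonoidHom)
    (MonoidHom.ofInjective D.injective_lift_generator).symm.surjective)

section Pairing

theorem setOf_matrix_smul_eq {i : ι} {x : ℝ} (hx : x ^ 2 = D.centre i ^ 2 - D.radius i ^ 2) :
    {ξ : OnePoint ℝ | (D.matrix i : GL (Fin 2) ℝ) • ξ = ξ} =
      {((-x : ℝ) : OnePoint ℝ), (x : OnePoint ℝ)} := by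
  have hr := D.radius_pos i
  have h_entries (m n : Fin 2) : (D.matrix i : GL (Fin 2) ℝ) m n =
      (D.radius i)⁻¹ * !![D.centre i, x ^ 2; 1, D.centre i] m n := by rw [hx]; rfl
  ext ξ
  induction ξ using OnePoint.rec with
  | infty => simp [OnePoint.smul_infty_eq_self_iff, h_entries, hr.ne']
  | coe y =>
    rw [Set.mem_ofPred_eq, OnePoint.smul_some_eq_ite]
    simp only [h_entries, Matrix.of_apply, Matrix.cons_val', Matrix.cons_val_zero,
      Matrix.cons_val_one, Matrix.cons_val_fin_one, mul_assoc, ← mul_add, mul_one,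
      mul_eq_zero, inv_eq_zero, hr.ne', false_or, Set.mem_insert_iff, Set.mem_singleton_iff]
    by_cases h : y + D.centre i = 0
    · rw [if_pos h]
      have hy : y ^ 2 ≠ x ^ 2 := by
        rw [eq_neg_of_add_eq_zero_left h, hx]
        nlinarith
      simp only [OnePoint.infty_ne_coe, OnePoint.coe_eq_coe, false_iff]
      rintro (rfl | rfl) <;> simp at hy
    · rw [if_neg h, mul_div_mul_left _ _ (inv_ne_zero hr.ne'), OnePoint.coe_eq_coe, div_eq_iff h,
        OnePoint.coe_eq_coe, OnePoint.coe_eq_coe, or_comm, ← sq_eq_sq_iff_eq_or_eq_neg]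
      constructor <;> intro e <;> linear_combination -e

theorem norm_coe_generator_sub_centre (i : ι) (z : ℍ) :
    ‖(D.generator i z : ℂ) - D.centre i‖ =
      D.radius i ^ 2 / ‖(z : ℂ) - (-D.centre i : ℝ)‖ := by
  rw [coe_generator]
  simpa [signedCentre] using D.norm_letterMap_sub (i, true) z

theorem generator_image_halfCircle (i : ι) :
    D.generator i '' halfCircle (-D.centre i) (D.radius i) =
      halfCircle (D.centre i) (D.radius i) := by
  rw [← (D.generator i).surjective.image_preimage (halfCircle (D.centre i) _)]
  congr 1
  ext z
  have hz := norm_pos_iff.2 (sub_ne_zero.2 (coe_ne_ofReal z (-D.centre i)))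
  change ‖_‖ = _ ↔ ‖_‖ = _
  rw [norm_coe_generator_sub_centre, div_eq_iff hz.ne', sq, mul_right_inj' (D.radius_pos i).ne',
    eq_comm]

theorem generator_image_halfCircleExt (i : ι) :
    D.generator i '' halfCircleExt (-D.centre i) (D.radius i) =
      halfDisc (D.centre i) (D.radius i) := by
  rw [← (D.generator i).surjective.image_preimage (halfDisc (D.centre i) _)]
  congr 1
  ext z
  have hz := norm_pos_iff.2 (sub_ne_zero.2 (coe_ne_ofReal z (-D.centre i)))
  change _ < ‖_‖ ↔ ‖_‖ < _
  rw [norm_coe_generator_sub_centre, div_lt_iff₀ hz, sq, mul_lt_mul_iff_right₀ (D.radius_pos i)]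

end Pairing

end SchottkySystem

/-! ### Hausdorff content and contractions -/

section HausdorffContent

open MeasureTheory
open scoped NNReal

variable {X Y : Type*} [EMetricSpace X] [EMetricSpace Y] {s : ℝ} {δ ε : ℝ≥0∞} {A : Set X}

/-- The Hausdorff content of dimension `s` and scale `δ`: the infimum of `∑ (diam Uₙ) ^ s` over all
covers by sets `Uₙ` of diameter at most `δ`. -/
def hausdorffContent (s : ℝ) (δ : ℝ≥0∞) : OuterMeasure X :=
  OuterMeasure.mkMetric'.pre (fun A => Metric.ediam A ^ s) δ

theorem hausdorffContent_le (h : Metric.ediam A ≤ δ) :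
    hausdorffContent s δ A ≤ Metric.ediam A ^ s :=
  OuterMeasure.mkMetric'.pre_le h

theorem hausdorffContent_image_le (hs : 0 < s) {g : X → Y} {u : ℝ≥0} (hg : LipschitzOnWith u g A)
    (hδ : u * δ ≤ ε) : hausdorffContent s ε (g '' A) ≤ u ^ s * hausdorffContent s δ A := by
  have h_ediam (B : Set X) : Metric.ediam (g '' (B ∩ A)) ≤ u * Metric.ediam B := by
    simpa using ((hg.mono Set.inter_subset_right).holderOnWith.ediam_image_le_of_le
      (Metric.ediam_mono Set.inter_subset_left))
  rcases eq_or_ne u 0 with rfl | hu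
  · have h_zero : Metric.ediam (g '' A) = 0 := by simpa using h_ediam A
    calc hausdorffContent s ε (g '' A) ≤ Metric.ediam (g '' A) ^ s :=
          hausdorffContent_le (h_zero ▸ zero_le)
      _ ≤ _ := by rw [h_zero, ENNReal.zero_rpow_of_pos hs]; exact zero_le
  have hu_rpow : (u : ℝ≥0∞) ^ s ≠ 0 := by simp [hu]
  have h_le : OuterMeasure.restrict A (OuterMeasure.comap g (hausdorffContent s ε)) ≤
      (u : ℝ≥0∞) ^ s • hausdorffContent s δ := by
    change _ ≤ _ • OuterMeasure.boundedBy _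
    rw [OuterMeasure.smul_boundedBy (ENNReal.rpow_ne_top_of_nonneg hs.le ENNReal.coe_ne_top),
      OuterMeasure.le_boundedBy]
    intro B
    rw [OuterMeasure.restrict_apply, OuterMeasure.comap_apply, Pi.smul_apply, smul_eq_mul]
    by_cases hB : Metric.ediam B ≤ δ
    · rw [extend_eq (P := fun B => Metric.ediam B ≤ δ) _ hB, ← ENNReal.mul_rpow_of_nonneg _ _ hs.le]
      have h_scale : Metric.ediam (g '' (B ∩ A)) ≤ ε :=
        (h_ediam B).trans ((mul_le_mul_right hB _).trans hδ)
      exact (OuterMeasure.mkMetric'.pre_le h_scale).trans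
        (ENNReal.rpow_le_rpow (h_ediam B) hs.le)
    · simp [extend, hB, ENNReal.mul_top hu_rpow]
  simpa using h_le A

theorem hausdorffMeasure_le_of_hausdorffContent_le [MeasurableSpace X] [BorelSpace X]
    {δ : ℕ → ℝ≥0∞} (hδ : Tendsto δ atTop (𝓝 0)) {M : ℝ≥0∞}
    (h : ∀ n, hausdorffContent s (δ n) A ≤ M) : Measure.hausdorffMeasure s A ≤ M := by
  rw [← Measure.coe_toOuterMeasure, Measure.hausdorffMeasure, Measure.mkMetric_toOuterMeasure,
    OuterMeasure.mkMetric, OuterMeasure.mkMetric']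
  simp only [OuterMeasure.iSup_apply]
  refine iSup₂_le fun r hr => ?_
  obtain ⟨n, hn⟩ := (hδ.eventually (gt_mem_nhds hr)).exists
  exact (OuterMeasure.mkMetric'.mono_pre _ hn.le A).trans (h n)

variable {κ : Type*} [Countable κ] {T : Set X} {V : κ → Set X} {g : κ → X → X} {u : κ → ℝ≥0}

theorem hausdorffContent_le_of_subset_iUnion_image (hs : 0 < s)
    (hg : ∀ a, LipschitzOnWith (u a) (g a) (V a)) (hδ : ∀ a, u a * δ ≤ ε)
    (hT : T ⊆ ⋃ a, g a '' (T ∩ V a)) (hu : ∑' a, (u a : ℝ≥0∞) ^ s ≤ 1) :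
    hausdorffContent s ε T ≤ hausdorffContent s δ T :=
  calc hausdorffContent s ε T ≤ ∑' a, hausdorffContent s ε (g a '' (T ∩ V a)) :=
        (measure_mono hT).trans (measure_iUnion_le _)
    _ ≤ ∑' a, (u a : ℝ≥0∞) ^ s * hausdorffContent s δ T :=
        ENNReal.tsum_le_tsum fun a =>
          (hausdorffContent_image_le hs ((hg a).mono Set.inter_subset_right) (hδ a)).trans
            (mul_le_mul_right (measure_mono Set.inter_subset_left) _)
    _ ≤ hausdorffContent s δ T := by
        rw [ENNReal.tsum_mul_right]
        exact mul_le_of_le_one_left' hu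

theorem dimH_le_of_subset_iUnion_image {s q : ℝ≥0} (hs : 0 < s) (hq : q < 1) (huq : ∀ a, u a ≤ q)
    (hg : ∀ a, LipschitzOnWith (u a) (g a) (V a)) (hT : T ⊆ ⋃ a, g a '' (T ∩ V a))
    (hu : ∑' a, (u a : ℝ≥0∞) ^ (s : ℝ) ≤ 1) {δ : ℝ≥0} (hfin : hausdorffContent s δ T ≠ ∞) :
    dimH T ≤ s := by
  borelize X
  have h_scale (n : ℕ) : hausdorffContent s ((q : ℝ≥0∞) ^ n * δ) T ≤ hausdorffContent s δ T := by
    induction n with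
    | zero => simp
    | succ n ih =>
      refine (hausdorffContent_le_of_subset_iUnion_image hs hg (fun a => ?_) hT hu).trans ih
      rw [pow_succ', mul_assoc]
      gcongr
      exact huq a
  have h_tendsto : Tendsto (fun n : ℕ => (q : ℝ≥0∞) ^ n * δ) atTop (𝓝 0) := by
    simpa using ENNReal.Tendsto.mul_const
      (ENNReal.tendsto_pow_atTop_nhds_zero_of_lt_one (ENNReal.coe_lt_one_iff.2 hq))
      (Or.inr ENNReal.coe_ne_top)
  exact dimH_le_of_hausdorffMeasure_ne_top (ne_top_of_le_ne_top hfin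
    (hausdorffMeasure_le_of_hausdorffContent_le h_tendsto h_scale))

end HausdorffContent

/-! ### Points coded by reduced words -/

theorem tsum_prod_bool_fst {α : Type*} (f : α → ℝ≥0∞) :
    ∑' a : α × Bool, f a.1 = 2 * ∑' i, f i :=
  calc ∑' a : α × Bool, f a.1 = ∑' i, ∑' _ : Bool, f i := ENNReal.tsum_prod (f := fun i _ => f i)
    _ = 2 * ∑' i, f i := by simp_rw [tsum_bool, ← two_mul, ENNReal.tsum_mul_left]

namespace SchottkySystem

variable {ι : Type*} (D : SchottkySystem ι)

section Coding

open MeasureTheory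
open scoped NNReal

/-- The infinite reduced word `A` codes the point `X 0`, and its shifts code the points `X n`. -/
structure IsCoding (A : ℕ → ι × Bool) (X : ℕ → ℂ) : Prop where
  nonCancelling : ∀ n, NonCancelling (A n) (A (n + 1))
  mem_disc : ∀ n, X n ∈ D.disc (A n)
  letterMap_succ : ∀ n, D.letterMap (A n) (X (n + 1)) = X n

/-- The points coded by a word whose letters from the `N`-th one on have their index in `S`. -/
def codedSet (S : Set ι) (N : ℕ) : Set ℂ :=
  {z | ∃ A X, D.IsCoding A X ∧ X 0 = z ∧ ∀ n ≥ N, (A n).1 ∈ S}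

variable {D}

theorem IsCoding.mem_domain {A : ℕ → ι × Bool} {X : ℕ → ℂ} (h : D.IsCoding A X) (n : ℕ) :
    X (n + 1) ∈ D.domain (A n) :=
  D.disc_subset_domain (h.nonCancelling n) (h.mem_disc (n + 1))

theorem IsCoding.shift {A : ℕ → ι × Bool} {X : ℕ → ℂ} (h : D.IsCoding A X) :
    D.IsCoding (fun n => A (n + 1)) fun n => X (n + 1) :=
  ⟨fun n => h.nonCancelling (n + 1), fun n => h.mem_disc (n + 1), fun n => h.letterMap_succ (n + 1)⟩

variable (D)

theorem codedSet_zero_subset (S : Set ι) : D.codedSet S 0 ⊆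
    ⋃ a : S × Bool, D.letterMap (a.1, a.2) '' (D.codedSet S 0 ∩ D.domain (a.1, a.2)) := by
  rintro _ ⟨A, X, h, rfl, hA⟩
  exact Set.mem_iUnion.2 ⟨(⟨(A 0).1, hA 0 le_rfl⟩, (A 0).2), X 1,
    ⟨⟨_, _, h.shift, rfl, fun n _ => hA (n + 1) (Nat.zero_le _)⟩, h.mem_domain 0⟩,
    h.letterMap_succ 0⟩

theorem codedSet_succ_subset (S : Set ι) (N : ℕ) :
    D.codedSet S (N + 1) ⊆ ⋃ a, D.letterMap a '' (D.codedSet S N ∩ D.domain a) := by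
  rintro _ ⟨A, X, h, rfl, hA⟩
  exact Set.mem_iUnion.2 ⟨A 0, X 1,
    ⟨⟨_, _, h.shift, rfl, fun n hn => hA (n + 1) (Nat.succ_le_succ hn)⟩, h.mem_domain 0⟩,
    h.letterMap_succ 0⟩

theorem codedSet_subset_iUnion_disc (S : Set ι) (N : ℕ) : D.codedSet S N ⊆ ⋃ a, D.disc a := by
  rintro _ ⟨A, X, h, rfl, -⟩
  exact Set.mem_iUnion.2 ⟨A 0, h.mem_disc 0⟩

theorem ediam_disc_le (a : ι × Bool) :
    Metric.ediam (D.disc a) ≤ 2 * ENNReal.ofReal (D.radius a.1) := by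
  rw [disc, ← Metric.closedEBall_ofReal (D.radius_pos _).le]
  exact Metric.ediam_closedEBall_le

variable [Countable ι] {D} {S : Set ι} {s : ℝ≥0}

theorem hausdorffContent_iUnion_disc_ne_top
    (h : ∑' i, ENNReal.ofReal (D.radius i) ^ (s : ℝ) ≠ ∞) :
    hausdorffContent s (1 / 2 : ℝ≥0) (⋃ a, D.disc a) ≠ ∞ := by
  have h_two : (2 : ℝ≥0∞) ^ (s : ℝ) ≠ ∞ := by simp
  have h_scale (i : ι) : 2 * ENNReal.ofReal (D.radius i) ≤ (1 / 2 : ℝ≥0) := by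
    rw [← ENNReal.ofReal_ofNat 2, ← ENNReal.ofReal_mul zero_le_two, ENNReal.ofReal_le_coe]
    push_cast
    linarith [D.radius_le i]
  refine ne_top_of_le_ne_top (ENNReal.mul_ne_top (ENNReal.mul_ne_top ENNReal.ofNat_ne_top h_two) h)
    (b := 2 * 2 ^ (s : ℝ) * ∑' i, ENNReal.ofReal (D.radius i) ^ (s : ℝ)) ?_
  calc _ ≤ ∑' a, hausdorffContent s (1 / 2 : ℝ≥0) (D.disc a) := measure_iUnion_le _
    _ ≤ ∑' a : ι × Bool, (2 * ENNReal.ofReal (D.radius a.1)) ^ (s : ℝ) :=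
      ENNReal.tsum_le_tsum fun a =>
        (hausdorffContent_le ((D.ediam_disc_le a).trans (h_scale a.1))).trans
          (ENNReal.rpow_le_rpow (D.ediam_disc_le a) s.coe_nonneg)
    _ = 2 * 2 ^ (s : ℝ) * ∑' i, ENNReal.ofReal (D.radius i) ^ (s : ℝ) := by
      rw [tsum_prod_bool_fst fun i => (2 * ENNReal.ofReal (D.radius i)) ^ (s : ℝ)]
      simp only [ENNReal.mul_rpow_of_nonneg _ _ s.coe_nonneg, ENNReal.tsum_mul_left, mul_assoc]

theorem dimH_codedSet_le (hs : 0 < s) (hS : 2 * ∑' i : S, (D.ratio i : ℝ≥0∞) ^ (s : ℝ) ≤ 1)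
    (h : ∑' i, ENNReal.ofReal (D.radius i) ^ (s : ℝ) ≠ ∞) (N : ℕ) :
    dimH (D.codedSet S N) ≤ s := by
  induction N with
  | zero =>
    refine dimH_le_of_subset_iUnion_image hs (q := 9 / 16) ?_ (fun a => D.ratio_le a.1)
      (fun a => D.lipschitzOnWith_letterMap (a.1, a.2)) (D.codedSet_zero_subset S) ?_
      (ne_top_of_le_ne_top (hausdorffContent_iUnion_disc_ne_top h)
        (measure_mono (D.codedSet_subset_iUnion_disc S 0)))
    · rw [← NNReal.coe_lt_coe]
      norm_num
    · rwa [tsum_prod_bool_fst fun i : S => (D.ratio i : ℝ≥0∞) ^ (s : ℝ)]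
  | succ N ih =>
    refine (dimH_mono (D.codedSet_succ_subset S N)).trans ?_
    rw [dimH_iUnion]
    exact iSup_le fun a => (((D.lipschitzOnWith_letterMap a).mono
      Set.inter_subset_right).dimH_image_le).trans ((dimH_mono Set.inter_subset_left).trans ih)

end Coding

end SchottkySystem

/-! ### Coding of the limit points -/

namespace SchottkySystem

variable {ι : Type*} (D : SchottkySystem ι)

section LimitPoints

/-- The points of the orbit of `I` given by the reduced words which begin with `a`. -/
def wordOrbit (a : ι × Bool) : Set ℂ :=
  {z | ∃ L, FreeGroup.IsReduced (a :: L) ∧ (D.wordIsom (a :: L) I : ℂ) = z}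

/-- The orbit under words of `I` and of the centres: the limit points which may fail to be coded by
an infinite word. -/
def exceptionalSet : Set ℂ :=
  ⋃ L : List (ι × Bool), (fun z => L.foldr D.letterMap z) ''
    insert Complex.I (Set.range fun a => (D.signedCentre a : ℂ))

theorem countable_exceptionalSet [Countable ι] : D.exceptionalSet.Countable :=
  Set.countable_iUnion fun _ => ((Set.countable_range _).insert _).image _

theorem subset_exceptionalSet :
    insert Complex.I (Set.range fun a => (D.signedCentre a : ℂ)) ⊆ D.exceptionalSet :=
  fun z hz => Set.mem_iUnion.2 ⟨[], z, hz, rfl⟩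

theorem letterMap_mem_exceptionalSet (a : ι × Bool) {z : ℂ} (hz : z ∈ D.exceptionalSet) :
    D.letterMap a z ∈ D.exceptionalSet := by
  obtain ⟨L, w, hw, rfl⟩ := Set.mem_iUnion.1 hz
  exact Set.mem_iUnion.2 ⟨a :: L, w, hw, rfl⟩

theorem wordOrbit_subset_disc (a : ι × Bool) : D.wordOrbit a ⊆ D.disc a := by
  rintro _ ⟨L, hL, rfl⟩
  exact D.wordIsom_I_mem_disc hL

theorem closure_wordOrbit_subset_disc (a : ι × Bool) : closure (D.wordOrbit a) ⊆ D.disc a :=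
  closure_minimal (D.wordOrbit_subset_disc a) Metric.isClosed_closedBall

theorem locallyFinite_disc : LocallyFinite D.disc := by
  refine fun z => ⟨Metric.ball z (1 / 24), Metric.ball_mem_nhds z (by norm_num),
    Set.Subsingleton.finite ?_⟩
  rintro a ⟨v, hv, hvz⟩ b ⟨w, hw, hwz⟩
  by_contra hab
  have h_far := D.max_centre_div_three_add_le (nonCancelling_invLetter_of_ne hab)
  have h_max := le_max_left (D.centre a.1) (D.centre (invLetter b).1)
  have h_eq : dist (D.signedCentre a : ℂ) (D.signedCentre b) =
      |D.signedCentre a + D.signedCentre (invLetter b)| := by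
    rw [signedCentre_invLetter, ← sub_eq_add_neg, Complex.dist_eq, ← Complex.ofReal_sub,
      Complex.norm_real, Real.norm_eq_abs]
  have h_near : dist (D.signedCentre a : ℂ) (D.signedCentre b) ≤
      dist v (D.signedCentre a) + dist v z + (dist w z + dist w (D.signedCentre b)) :=
    (dist_triangle4 _ v w _).trans (by
      linarith [dist_comm (D.signedCentre a : ℂ) v, dist_triangle_right v w z])
  rw [Metric.mem_ball] at hvz hwz
  linarith [Metric.mem_closedBall.1 hv, Metric.mem_closedBall.1 hw, D.radius_le a.1,
    D.radius_le b.1, D.one_le_centre a.1]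

theorem locallyFinite_wordOrbit : LocallyFinite D.wordOrbit :=
  D.locallyFinite_disc.subset D.wordOrbit_subset_disc

variable {D}

theorem eq_I_or_exists_mem_closure_wordOrbit {E : Set ℂ} {P : Set (ι × Bool)}
    (hE : E ⊆ {Complex.I} ∪ ⋃ a ∈ P, D.wordOrbit a) {z : ℂ} (hz : z ∈ closure E) :
    z = Complex.I ∨ ∃ a ∈ P, z ∈ closure (D.wordOrbit a) := by
  have h_finite : LocallyFinite fun a : P => D.wordOrbit a :=
    D.locallyFinite_wordOrbit.comp_injective Subtype.val_injective
  have hz := closure_mono hE hz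
  rw [closure_union, closure_singleton, Set.biUnion_eq_iUnion, h_finite.closure_iUnion] at hz
  simpa using hz

theorem eq_I_or_exists_mem_closure_wordOrbit_of_mem_closure_orbit {z : ℂ}
    (hz : z ∈ closure ((fun w : ℍ => (w : ℂ)) '' orbit D.group I)) :
    z = Complex.I ∨ ∃ a, z ∈ closure (D.wordOrbit a) := by
  have h_subset : (fun w : ℍ => (w : ℂ)) '' orbit D.group I ⊆
      {Complex.I} ∪ ⋃ a ∈ Set.univ, D.wordOrbit a := by
    rintro _ ⟨_, ⟨γ, hγ, rfl⟩, rfl⟩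
    obtain ⟨_ | ⟨a, L⟩, hL, rfl⟩ := D.exists_isReduced_of_mem_group hγ
    · exact Or.inl rfl
    · exact Or.inr (Set.mem_biUnion (Set.mem_univ a) ⟨L, hL, rfl⟩)
  simpa using eq_I_or_exists_mem_closure_wordOrbit h_subset hz

theorem letterMap_invLetter_wordIsom (a : ι × Bool) (L : List (ι × Bool)) (z : ℍ) :
    D.letterMap (invLetter a) (D.wordIsom (a :: L) z) = D.wordIsom L z := by
  have h_inv := D.letterMap_letterMap_invLetter (invLetter a) (z := D.wordIsom L z)
    (coe_ne_ofReal _ _)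
  rwa [invLetter_invLetter, ← coe_wordIsom_cons] at h_inv

theorem continuousAt_letterMap {a : ι × Bool} {z : ℂ} (hz : z + D.signedCentre a ≠ 0) :
    ContinuousAt (D.letterMap a) z :=
  continuousAt_const.sub (continuousAt_const.div (by fun_prop) hz)

theorem letterMap_eq_I_or_exists_mem_closure_wordOrbit {a : ι × Bool} {z : ℂ}
    (hz : z ∈ closure (D.wordOrbit a)) (hza : z ≠ D.signedCentre a) :
    D.letterMap (invLetter a) z = Complex.I ∨
      ∃ b, NonCancelling a b ∧ D.letterMap (invLetter a) z ∈ closure (D.wordOrbit b) := by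
  have hza' : z + D.signedCentre (invLetter a) ≠ 0 := by
    rwa [signedCentre_invLetter, Complex.ofReal_neg, ← sub_eq_add_neg, sub_ne_zero]
  refine eq_I_or_exists_mem_closure_wordOrbit (P := {b | NonCancelling a b}) ?_
    (mem_closure_image (continuousAt_letterMap hza') hz)
  rintro _ ⟨_, ⟨L, hL, rfl⟩, rfl⟩
  rw [letterMap_invLetter_wordIsom]
  cases L with
  | nil => exact Or.inl rfl
  | cons b L =>
    rw [FreeGroup.isReduced_cons_cons] at hL
    exact Or.inr (Set.mem_biUnion (x := b) hL.1 ⟨L, hL.2, rfl⟩)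

theorem exists_isCoding_of_mem_closure_wordOrbit {a : ι × Bool} {z : ℂ}
    (hz : z ∈ closure (D.wordOrbit a)) (hz' : z ∉ D.exceptionalSet) :
    ∃ A X, D.IsCoding A X ∧ X 0 = z := by
  let T := {p : (ι × Bool) × ℂ // p.2 ∈ closure (D.wordOrbit p.1) ∧ p.2 ∉ D.exceptionalSet}
  have h_next (p : T) :
      ∃ q : T, NonCancelling p.1.1 q.1.1 ∧ D.letterMap p.1.1 q.1.2 = p.1.2 := by
    obtain ⟨⟨a, z⟩, hz, hz'⟩ := p
    have hza : z ≠ D.signedCentre a := fun e => hz' (D.subset_exceptionalSet (Or.inr ⟨a, e.symm⟩))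
    have h_inv := D.letterMap_letterMap_invLetter a hza
    have h_exc : D.letterMap (invLetter a) z ∉ D.exceptionalSet := fun h =>
      hz' (h_inv ▸ D.letterMap_mem_exceptionalSet a h)
    obtain h_eq | ⟨b, hab, hb⟩ := letterMap_eq_I_or_exists_mem_closure_wordOrbit hz hza
    · exact absurd (D.subset_exceptionalSet (Or.inl h_eq)) h_exc
    · exact ⟨⟨(b, D.letterMap (invLetter a) z), hb, h_exc⟩, hab, h_inv⟩
  choose next h_nonCancelling h_letterMap using h_next
  let p (n : ℕ) : T := next^[n] ⟨(a, z), hz, hz'⟩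
  have hp (n : ℕ) : p (n + 1) = next (p n) := Function.iterate_succ_apply' _ _ _
  refine ⟨fun n => (p n).1.1, fun n => (p n).1.2, ⟨fun n => ?_, fun n => ?_, fun n => ?_⟩, rfl⟩
  · exact hp n ▸ h_nonCancelling (p n)
  · exact D.closure_wordOrbit_subset_disc _ (p n).2.1
  · exact hp n ▸ h_letterMap (p n)

theorem exists_isCoding {z : ℂ} (hz : z ∈ closure ((fun w : ℍ => (w : ℂ)) '' orbit D.group I))
    (hz' : z ∉ D.exceptionalSet) : ∃ A X, D.IsCoding A X ∧ X 0 = z := by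
  obtain rfl | ⟨a, ha⟩ := eq_I_or_exists_mem_closure_wordOrbit_of_mem_closure_orbit hz
  · exact absurd (D.subset_exceptionalSet (Set.mem_insert _ _)) hz'
  · exact exists_isCoding_of_mem_closure_wordOrbit ha hz'

end LimitPoints

end SchottkySystem

/-! ### The Cayley transform and the boundary -/

section Boundary

/-- The Cayley transform of the plane, which extends `discMap` and `bdryMap`. -/
def cayley (o : ℍ) (z : ℂ) : ℂ := (z - o) / (z - conj (o : ℂ))

/-- The inverse of the Cayley transform. -/
def cayleyInv (o : ℍ) (ζ : ℂ) : ℂ := (o - conj (o : ℂ) * ζ) / (1 - ζ)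

theorem discMap_eq_cayley (o z : ℍ) : discMap o z = cayley o z := rfl

variable (o : ℍ) {z w : ℂ}

theorem im_le_norm_sub_conj (hz : 0 ≤ z.im) : o.im ≤ ‖z - conj (o : ℂ)‖ := by
  calc o.im ≤ (z - conj (o : ℂ)).im := by simpa using hz
    _ ≤ _ := (le_abs_self _).trans (Complex.abs_im_le_norm _)

theorem sub_conj_ne_zero_of_nonneg_im (hz : 0 ≤ z.im) : z - conj (o : ℂ) ≠ 0 :=
  norm_pos_iff.1 (o.im_pos.trans_le (im_le_norm_sub_conj o hz))

theorem norm_cayley_sub_cayley (hz : 0 ≤ z.im) (hw : 0 ≤ w.im) : ‖cayley o z - cayley o w‖ =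
    2 * o.im * ‖z - w‖ / (‖z - conj (o : ℂ)‖ * ‖w - conj (o : ℂ)‖) := by
  have hz' := sub_conj_ne_zero_of_nonneg_im o hz
  have hw' := sub_conj_ne_zero_of_nonneg_im o hw
  have h_sub : cayley o z - cayley o w = (o - conj (o : ℂ)) * (z - w) /
      ((z - conj (o : ℂ)) * (w - conj (o : ℂ))) := by
    simp only [cayley]
    field_simp
    ring
  have h_norm : ‖(o : ℂ) - conj (o : ℂ)‖ = 2 * o.im := by
    simp [Complex.sub_conj, abs_of_pos o.im_pos]
  rw [h_sub, norm_div, norm_mul, norm_mul, h_norm]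

theorem lipschitzOnWith_cayley :
    LipschitzOnWith (2 / o.im).toNNReal (cayley o) {z | 0 ≤ z.im} := by
  refine LipschitzOnWith.of_dist_le_mul fun z hz w hw => ?_
  have ho := o.im_pos
  have hz' := im_le_norm_sub_conj o hz
  have hw' := im_le_norm_sub_conj o hw
  rw [dist_eq_norm, dist_eq_norm, norm_cayley_sub_cayley o hz hw,
    Real.coe_toNNReal _ (by positivity), div_le_iff₀ (mul_pos (ho.trans_le hz') (ho.trans_le hw'))]
  calc 2 * o.im * ‖z - w‖ = 2 / o.im * ‖z - w‖ * (o.im * o.im) := by field_simp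
    _ ≤ _ := by gcongr

theorem one_sub_cayley (hz : z - conj (o : ℂ) ≠ 0) :
    1 - cayley o z = (o - conj (o : ℂ)) / (z - conj (o : ℂ)) := by
  simp only [cayley]
  field_simp
  ring

theorem cayleyInv_cayley (hz : 0 ≤ z.im) : cayleyInv o (cayley o z) = z := by
  have hz' := sub_conj_ne_zero_of_nonneg_im o hz
  have ho := sub_conj_ne_zero o o
  rw [cayleyInv, one_sub_cayley o hz', cayley]
  field_simp
  ring

theorem continuousAt_cayleyInv (hz : 0 ≤ z.im) : ContinuousAt (cayleyInv o) (cayley o z) := by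
  have hz' := sub_conj_ne_zero_of_nonneg_im o hz
  refine ContinuousAt.div (by fun_prop) (by fun_prop) ?_
  rw [one_sub_cayley o hz']
  exact div_ne_zero (sub_conj_ne_zero o o) hz'

theorem tendsto_coe_nhdsInfty (x : ℝ) :
    Tendsto (fun z : ℍ => (z : ℂ)) (nhdsInfty o (x : OnePoint ℝ)) (𝓝 (x : ℂ)) := by
  have hx : 0 ≤ (x : ℂ).im := by simp
  have h := (continuousAt_cayleyInv o hx).tendsto.comp
    (tendsto_comap : Tendsto (discMap o) (nhdsInfty o (x : OnePoint ℝ)) _)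
  rw [cayleyInv_cayley o hx] at h
  exact h.congr fun z => cayleyInv_cayley o z.im_pos.le

variable {o} {Γ : Subgroup (ℍ ≃ᵢ ℍ)} {x : ℝ}

theorem mem_closure_coe_orbit_of_mem_limitSet (hx : (x : OnePoint ℝ) ∈ limitSet Γ o) :
    (x : ℂ) ∈ closure ((fun z : ℍ => (z : ℂ)) '' orbit Γ o) := by
  have hx' : 0 ≤ (x : ℂ).im := by simp
  have h := mem_closure_image (continuousAt_cayleyInv o hx') hx
  rw [cayleyInv_cayley o hx', Set.image_image] at h
  simpa only [discMap_eq_cayley, cayleyInv_cayley o (UpperHalfPlane.im_pos _).le] using h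

theorem mem_closure_coe_orbit_of_mem_closure (o' : ℍ)
    (hx : (x : ℂ) ∈ closure ((fun z : ℍ => (z : ℂ)) '' orbit Γ o)) :
    (x : ℂ) ∈ closure ((fun z : ℍ => (z : ℂ)) '' orbit Γ o') := by
  rw [Metric.mem_closure_iff] at hx ⊢
  intro ε hε
  obtain ⟨_, ⟨_, ⟨γ, hγ, rfl⟩, rfl⟩, h⟩ := hx (ε / Real.exp (dist o' o)) (by positivity)
  refine ⟨_, ⟨_, ⟨γ, hγ, rfl⟩, rfl⟩, ?_⟩
  rw [lt_div_iff₀ (Real.exp_pos _)] at h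
  have h_im : (γ o).im ≤ dist (x : ℂ) (γ o) := by
    simpa [Complex.dist_eq, abs_of_pos (γ o).im_pos] using
      Complex.abs_im_le_norm ((x : ℂ) - (γ o : ℍ))
  calc dist (x : ℂ) (γ o' : ℍ) ≤ dist (x : ℂ) (γ o) + dist (γ o' : ℂ) (γ o) :=
        dist_triangle_right _ _ _
    _ ≤ dist (x : ℂ) (γ o) + dist (x : ℂ) (γ o) * (Real.exp (dist o' o) - 1) := by
        have h_dist := UpperHalfPlane.dist_coe_le (γ o') (γ o)
        rw [γ.dist_eq] at h_dist
        have h_one : 0 ≤ Real.exp (dist o' o) - 1 := sub_nonneg.2 (Real.one_le_exp dist_nonneg)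
        gcongr
        exact h_dist.trans (by gcongr)
    _ < ε := by linarith

theorem hausdorffDim_le_dimH {S : Set (OnePoint ℝ)} {T : Set ℂ}
    (h : ∀ x : ℝ, (x : OnePoint ℝ) ∈ S → (x : ℂ) ∈ T) : hausdorffDim o S ≤ dimH T := by
  have h_subset : bdryMap o '' S ⊆ {1} ∪ cayley o '' (T ∩ {z | 0 ≤ z.im}) := by
    rintro _ ⟨ξ, hξ, rfl⟩
    induction ξ using OnePoint.rec with
    | infty => exact Or.inl rfl
    | coe x => exact Or.inr ⟨x, ⟨h x hξ, by simp⟩, rfl⟩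
  calc hausdorffDim o S ≤ max (dimH {1}) (dimH (cayley o '' (T ∩ {z | 0 ≤ z.im}))) :=
        (dimH_mono h_subset).trans (dimH_union _ _).le
    _ ≤ dimH T := by
        rw [dimH_singleton]
        exact max_le zero_le ((((lipschitzOnWith_cayley o).mono
          Set.inter_subset_right).dimH_image_le).trans (dimH_mono Set.inter_subset_left))

end Boundary

/-! ### Gromov products and geodesic rays -/

section GromovProduct

theorem sinh_half_dist_mul_le (a b c d : ℍ) :
    Real.sinh (dist a c / 2) * Real.sinh (dist b d / 2) ≤
      Real.sinh (dist a b / 2) * Real.sinh (dist c d / 2) +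
        Real.sinh (dist b c / 2) * Real.sinh (dist a d / 2) := by
  have h_ptolemy := EuclideanGeometry.mul_dist_le_mul_dist_add_mul_dist (a : ℂ) b c d
  have := Real.sqrt_pos.2 a.im_pos
  have := Real.sqrt_pos.2 b.im_pos
  have := Real.sqrt_pos.2 c.im_pos
  have := Real.sqrt_pos.2 d.im_pos
  simp only [UpperHalfPlane.sinh_half_dist, Real.sqrt_mul a.im_pos.le, Real.sqrt_mul b.im_pos.le,
    Real.sqrt_mul c.im_pos.le]
  calc _ = dist (a : ℂ) c * dist (b : ℂ) d / (4 * (√a.im * √b.im * √c.im * √d.im)) := by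
        field_simp; ring
    _ ≤ (dist (a : ℂ) b * dist (c : ℂ) d + dist (b : ℂ) c * dist (a : ℂ) d) /
        (4 * (√a.im * √b.im * √c.im * √d.im)) := by gcongr
    _ = _ := by field_simp; ring

theorem sinh_le_exp_div_two (x : ℝ) : Real.sinh x ≤ Real.exp x / 2 := by
  rw [Real.sinh_eq]
  linarith [Real.exp_pos (-x)]

theorem exp_div_four_le_sinh {x : ℝ} (hx : 1 ≤ x) : Real.exp x / 4 ≤ Real.sinh x := by
  have h_exp : 2 ≤ Real.exp x := by linarith [Real.add_one_le_exp x]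
  have h_inv : (Real.exp x)⁻¹ ≤ 2⁻¹ := inv_anti₀ two_pos h_exp
  rw [Real.sinh_eq, Real.exp_neg]
  linarith

theorem gromovProduct_nonneg (q z w : ℍ) : 0 ≤ gromovProduct q z w :=
  div_nonneg (sub_nonneg.2 (dist_triangle z q w)) zero_le_two

theorem gromovProduct_le_add_dist (q z z' w : ℍ) :
    gromovProduct q z w ≤ gromovProduct q z' w + dist z z' := by
  rw [gromovProduct, gromovProduct]
  linarith [dist_triangle z z' q, dist_triangle_left z' w z]

theorem gromovProduct_apply_left (γ : ℍ ≃ᵢ ℍ) (q z w : ℍ) :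
    gromovProduct (γ q) z w = gromovProduct q (γ⁻¹ z) (γ⁻¹ w) := by
  obtain ⟨z, rfl⟩ := γ.surjective z
  obtain ⟨w, rfl⟩ := γ.surjective w
  have h_inv (x : ℍ) : γ⁻¹ (γ x) = x := γ.symm_apply_apply x
  simp only [gromovProduct, γ.dist_eq, h_inv]

/- The hypotheses place `z` at the point of the segment from `x` to `y` where the inscribed circle
of the triangle `q x y` would touch it if the plane were Euclidean. -/
theorem dist_le_four_mul_exp_gromovProduct {q x y z : ℍ} (hxy : 2 ≤ dist x y)
    (hxz : dist x z = gromovProduct x q y) (hzy : dist z y = gromovProduct y q x) :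
    dist q z ≤ 4 * Real.exp (gromovProduct q x y) := by
  have h_sinh_mul_sinh {u v : ℝ} (hv : 0 ≤ v) (h : u + v = gromovProduct q x y + dist x y) :
      Real.sinh (u / 2) * Real.sinh (v / 2) ≤
        Real.exp (gromovProduct q x y / 2) * Real.exp (dist x y / 2) / 4 :=
    calc _ ≤ Real.exp (u / 2) / 2 * (Real.exp (v / 2) / 2) :=
          mul_le_mul (sinh_le_exp_div_two _) (sinh_le_exp_div_two _)
            (Real.sinh_nonneg_iff.2 (by linarith)) (by positivity)
      _ = _ := by
          rw [div_mul_div_comm, ← Real.exp_add, ← Real.exp_add, ← add_div, ← add_div, h]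
          norm_num
  have h_bound : dist q z / 2 * (Real.exp (dist x y / 2) / 4) ≤
      Real.exp (gromovProduct q x y / 2) * Real.exp (dist x y / 2) / 2 :=
    calc _ ≤ Real.sinh (dist q z / 2) * Real.sinh (dist x y / 2) := by
          gcongr
          · exact Real.self_le_sinh_iff.2 (by positivity)
          · exact exp_div_four_le_sinh (by linarith)
      _ ≤ _ := sinh_half_dist_mul_le q x z y
      _ ≤ _ := by
          linarith [h_sinh_mul_sinh (u := dist q x) (v := dist z y) dist_nonneg (by
              rw [hzy, gromovProduct, gromovProduct, dist_comm y x, dist_comm x q]; ring),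
            h_sinh_mul_sinh (u := dist x z) (v := dist q y) dist_nonneg (by
              rw [hxz, gromovProduct, gromovProduct, dist_comm x q]; ring)]
  have h_exp : Real.exp (gromovProduct q x y / 2) ≤ Real.exp (gromovProduct q x y) :=
    Real.exp_le_exp.2 (half_le_self (gromovProduct_nonneg q x y))
  nlinarith [Real.exp_pos (dist x y / 2)]

theorem norm_discMap_sub_div_two_le_exp_neg_gromovProduct (o z w : ℍ) :
    ‖discMap o z - discMap o w‖ / 2 ≤ Real.exp (-gromovProduct o z w) := by
  rw [exp_neg_gromovProduct, mul_assoc]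
  have h_one : 1 ≤ (1 + Real.exp (-dist z o)) * (1 + Real.exp (-dist w o)) := by
    nlinarith [Real.exp_pos (-dist z o), Real.exp_pos (-dist w o)]
  exact (le_mul_of_one_le_right (by positivity) h_one).trans
    (le_add_of_nonneg_right (by positivity))

theorem im_mul_norm_sub_div_le_exp_neg_gromovProduct (o z w : ℍ) :
    o.im * ‖(z : ℂ) - w‖ / (‖(z : ℂ) - conj (o : ℂ)‖ * ‖(w : ℂ) - conj (o : ℂ)‖) ≤
      Real.exp (-gromovProduct o z w) := by
  refine le_trans (le_of_eq ?_) (norm_discMap_sub_div_two_le_exp_neg_gromovProduct o z w)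
  rw [discMap_eq_cayley, discMap_eq_cayley, norm_cayley_sub_cayley o z.im_pos.le w.im_pos.le]
  ring

end GromovProduct

section GeodesicRays

variable {o : ℍ} {ξ : OnePoint ℝ} {c : ℝ → ℍ}

theorem IsGeodesicRay.dist_start (hc : IsGeodesicRay o ξ c) {t : ℝ} (ht : 0 ≤ t) :
    dist o (c t) = t := by
  rw [← hc.start, hc.dist_eq 0 t le_rfl ht, zero_sub, abs_neg, abs_of_nonneg ht]

theorem IsGeodesicRay.exists_dist_le (hc : IsGeodesicRay o ξ c) (q : ℍ) {s : ℝ} (hs : 2 ≤ s) :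
    ∃ t, 0 ≤ t ∧ dist q (c t) ≤ 4 * Real.exp (gromovProduct q o (c s)) := by
  have hs0 : 0 ≤ s := by linarith
  have h_os := hc.dist_start hs0
  have h_le : gromovProduct o q (c s) ≤ s := by
    rw [gromovProduct, h_os]
    linarith [dist_triangle_right q o (c s), dist_comm o (c s)]
  have h_nonneg := gromovProduct_nonneg o q (c s)
  refine ⟨_, h_nonneg, dist_le_four_mul_exp_gromovProduct (by rwa [h_os])
    (hc.dist_start h_nonneg) ?_⟩
  rw [hc.dist_eq _ _ h_nonneg hs0, abs_sub_comm, abs_of_nonneg (sub_nonneg.2 h_le), gromovProduct,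
    gromovProduct, dist_comm (c s) o, h_os, dist_comm q o]
  ring

theorem tendsto_dist_atTop_of_tendsto_im {κ : Type*} {l : Filter κ} {z : κ → ℍ} (o : ℍ)
    (hz : Tendsto (fun n => (z n).im) l (𝓝 0)) : Tendsto (fun n => dist o (z n)) l atTop := by
  refine tendsto_atTop.2 fun K => ?_
  have h_lim : Tendsto (fun n => (z n).im * Real.exp K) l (𝓝 0) := by
    simpa using hz.mul_const (Real.exp K)
  filter_upwards [h_lim.eventually_lt_const o.im_pos] with n hn
  have h_im := hn.trans_le (UpperHalfPlane.im_le_im_mul_exp_dist o (z n))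
  exact (Real.exp_lt_exp.1 (lt_of_mul_lt_mul_left h_im (z n).im_pos.le)).le

theorem IsGeodesicRay.eventually_forall_lt_dist (hc : IsGeodesicRay o ξ c)
    {Γ : Subgroup (ℍ ≃ᵢ ℍ)}
    (h_away : Tendsto (fun t => Metric.infDist (c t) (orbit Γ o)) atTop atTop)
    {κ : Type*} {l : Filter κ} {γ : κ → ℍ ≃ᵢ ℍ} (hγ : ∀ n, γ n ∈ Γ) {p : ℍ}
    (h_escape : Tendsto (fun n => dist o (γ n p)) l atTop) (K : ℝ) :
    ∀ᶠ n in l, ∀ t, 0 ≤ t → K < dist (γ n p) (c t) := by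
  obtain ⟨T, hT⟩ := eventually_atTop.1 (h_away.eventually_gt_atTop (K + dist p o))
  filter_upwards [h_escape.eventually_gt_atTop (K + T)] with n hn t ht
  rcases lt_or_ge t T with htT | htT
  · linarith [dist_triangle_right o (γ n p) (c t), hc.dist_start ht]
  · have h_orbit : Metric.infDist (c t) (orbit Γ o) ≤ dist (c t) (γ n o) :=
      Metric.infDist_le_dist_of_mem ⟨γ n, hγ n, rfl⟩
    linarith [hT t htT, dist_triangle_left (c t) (γ n o) (γ n p), (γ n).dist_eq p o]

end GeodesicRays

/-! ### Transient limit points -/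

namespace SchottkySystem

variable {ι : Type*} (D : SchottkySystem ι)

section Transience

/-- The isometry of the first `n` letters of an infinite word. -/
def prefixIsom (A : ℕ → ι × Bool) : ℕ → ℍ ≃ᵢ ℍ
  | 0 => 1
  | n + 1 => prefixIsom A n * D.letterIsom (A n)

theorem letterIsom_mem_group (a : ι × Bool) : D.letterIsom a ∈ D.group := by
  simpa using D.wordIsom_mem_group [a]

theorem prefixIsom_mem_group (A : ℕ → ι × Bool) (n : ℕ) : D.prefixIsom A n ∈ D.group := by
  induction n with
  | zero => exact one_mem _
  | succ n ih => exact mul_mem ih (D.letterIsom_mem_group _)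

theorem letterIsom_invLetter (a : ι × Bool) :
    D.letterIsom (invLetter a) = (D.letterIsom a)⁻¹ := by
  rcases a with ⟨i, _ | _⟩ <;> simp [letterIsom, invLetter]

theorem coe_prefixIsom_succ_inv (A : ℕ → ι × Bool) (n : ℕ) (z : ℍ) :
    (((D.prefixIsom A (n + 1))⁻¹ z : ℍ) : ℂ) =
      D.letterMap (invLetter (A n)) ((D.prefixIsom A n)⁻¹ z : ℍ) := by
  rw [← coe_letterIsom, letterIsom_invLetter, prefixIsom, mul_inv_rev]
  rfl

theorem im_letterMap (a : ι × Bool) (z : ℂ) : (D.letterMap a z).im =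
    D.radius a.1 ^ 2 * z.im / ‖z + D.signedCentre a‖ ^ 2 := by
  rw [Complex.sq_norm, letterMap, ← Complex.ofReal_pow]
  simp [Complex.div_im, -Complex.ofReal_pow]

theorem im_letterMap_le {a : ι × Bool} {z : ℂ} (hz : z ∈ D.domain a) (h_im : 0 ≤ z.im) :
    (D.letterMap a z).im ≤ 9 / 16 * z.im := by
  have hc := D.centre_pos a.1
  have h_ratio : (D.ratio a.1 : ℝ) ≤ 9 / 16 := by exact_mod_cast D.ratio_le a.1
  calc (D.letterMap a z).im = D.radius a.1 ^ 2 * z.im / ‖z + D.signedCentre a‖ ^ 2 :=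
        D.im_letterMap a z
    _ ≤ D.radius a.1 ^ 2 * z.im / (D.centre a.1 / 3) ^ 2 := by
        gcongr
        exact hz
    _ = D.ratio a.1 * z.im := by
        rw [coe_ratio]
        field_simp
    _ ≤ 9 / 16 * z.im := by gcongr

variable {D} {A : ℕ → ι × Bool} {X : ℕ → ℂ}

theorem im_prefixIsom_succ_le (hA : ∀ n, NonCancelling (A n) (A (n + 1))) (n : ℕ) {w : ℍ}
    (hw : (w : ℂ) ∈ D.domain (A n)) :
    (D.prefixIsom A (n + 1) w).im ≤ (9 / 16) ^ (n + 1) * w.im := by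
  have h_letter : (D.letterIsom (A n) w).im ≤ 9 / 16 * w.im := by
    rw [← coe_im, coe_letterIsom]
    exact D.im_letterMap_le hw w.im_pos.le
  induction n generalizing w with
  | zero => simpa [prefixIsom] using h_letter
  | succ n ih =>
    have h_mem : (D.letterIsom (A (n + 1)) w : ℂ) ∈ D.domain (A n) :=
      D.disc_subset_domain (hA n) (D.coe_letterIsom _ w ▸ D.mapsTo_letterMap _ hw)
    have h_im : (D.letterIsom (A n) (D.letterIsom (A (n + 1)) w)).im ≤
        9 / 16 * (D.letterIsom (A (n + 1)) w).im := by
      rw [← coe_im, coe_letterIsom]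
      exact D.im_letterMap_le h_mem (UpperHalfPlane.im_pos _).le
    calc _ ≤ (9 / 16) ^ (n + 1) * (D.letterIsom (A (n + 1)) w).im := ih h_mem h_im
      _ ≤ (9 / 16) ^ (n + 1) * (9 / 16 * w.im) := by gcongr
      _ = _ := by ring

theorem tendsto_dist_prefixIsom_succ (hA : ∀ n, NonCancelling (A n) (A (n + 1))) (o : ℍ) :
    Tendsto (fun n => dist o (D.prefixIsom A (n + 1) I)) atTop atTop := by
  refine tendsto_dist_atTop_of_tendsto_im o (squeeze_zero (fun n => (UpperHalfPlane.im_pos _).le)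
    (fun n => im_prefixIsom_succ_le hA n (D.I_mem_domain _)) ?_)
  simpa [Function.comp_def] using ((tendsto_pow_atTop_nhds_zero_of_lt_one (r := (9 / 16 : ℝ))
    (by norm_num) (by norm_num)).comp (tendsto_add_atTop_nat 1)).mul_const (I : ℍ).im

theorem prefixIsom_succ_inv_I_mem_disc (hA : ∀ n, NonCancelling (A n) (A (n + 1))) (n : ℕ) :
    (((D.prefixIsom A (n + 1))⁻¹ I : ℍ) : ℂ) ∈ D.disc (invLetter (A n)) := by
  rw [coe_prefixIsom_succ_inv]
  apply D.mapsTo_letterMap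
  induction n with
  | zero => exact D.I_mem_domain _
  | succ n ih =>
    refine D.disc_subset_domain (hA n).invLetter.symm ?_
    rw [coe_prefixIsom_succ_inv]
    exact D.mapsTo_letterMap _ ih

theorem IsCoding.disc_mem_nhds (h : D.IsCoding A X) (n : ℕ) : D.disc (A n) ∈ 𝓝 (X n) :=
  Metric.closedBall_mem_nhds_of_mem
    (h.letterMap_succ n ▸ D.mapsTo_letterMap_ball (A n) (h.mem_domain n))

theorem IsCoding.tendsto_prefixIsom_inv (h : D.IsCoding A X) {κ : Type*} {l : Filter κ} {c : κ → ℍ}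
    (hc : Tendsto (fun t => (c t : ℂ)) l (𝓝 (X 0))) (n : ℕ) :
    Tendsto (fun t => (((D.prefixIsom A n)⁻¹ (c t) : ℍ) : ℂ)) l (𝓝 (X n)) := by
  induction n with
  | zero => simpa [prefixIsom] using hc
  | succ n ih =>
    have h_dom := D.add_signedCentre_ne_zero (h.mem_domain n)
    have h_ne : X n + D.signedCentre (invLetter (A n)) ≠ 0 := by
      have hr := (D.radius_pos (A n).1).ne'
      rw [signedCentre_invLetter, Complex.ofReal_neg, ← sub_eq_add_neg, ← norm_pos_iff,
        ← h.letterMap_succ n, norm_letterMap_sub]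
      exact div_pos (by positivity) (norm_pos_iff.2 h_dom)
    have h_inv : D.letterMap (invLetter (A n)) (X n) = X (n + 1) := by
      have := D.letterMap_letterMap_invLetter (invLetter (A n)) (z := X (n + 1)) (by
        rwa [signedCentre_invLetter, Complex.ofReal_neg, ← sub_ne_zero, sub_neg_eq_add])
      rwa [invLetter_invLetter, h.letterMap_succ n] at this
    simpa only [coe_prefixIsom_succ_inv, h_inv, Function.comp_def] using
      (continuousAt_letterMap h_ne).tendsto.comp ih

theorem norm_add_I_le {a : ι × Bool} {z : ℂ} (hz : z ∈ D.disc a) :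
    ‖z + Complex.I‖ ≤ 3 * D.centre a.1 :=
  calc ‖z + Complex.I‖ = ‖(z - D.signedCentre a) + D.signedCentre a + Complex.I‖ := by
        rw [sub_add_cancel]
    _ ≤ ‖z - D.signedCentre a‖ + ‖(D.signedCentre a : ℂ)‖ + ‖Complex.I‖ := norm_add₃_le
    _ ≤ 1 / 4 + D.centre a.1 + 1 := by
        rw [Complex.norm_real, Real.norm_eq_abs, abs_signedCentre, Complex.norm_I]
        gcongr
        exact (mem_disc.1 hz).trans (D.radius_le _)
    _ ≤ 3 * D.centre a.1 := by linarith [D.one_le_centre a.1]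

theorem centre_div_twelve_le_norm_sub {a b : ι × Bool} (hab : NonCancelling a b) {z w : ℂ}
    (hz : z ∈ D.disc (invLetter a)) (hw : w ∈ D.disc b) : D.centre b.1 / 12 ≤ ‖z - w‖ := by
  have hz' : ‖z + D.signedCentre a‖ ≤ D.radius a.1 := by simpa [mem_disc] using hz
  have h_triangle := norm_sub_le (z + D.signedCentre a) (z - w)
  rw [add_sub_sub_cancel, add_comm] at h_triangle
  linarith [D.max_centre_div_three_le hab hw, le_max_right (D.centre a.1) (D.centre b.1),
    D.radius_le a.1, D.one_le_centre b.1]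

theorem exp_gromovProduct_le {a b : ι × Bool} (hab : NonCancelling a b) {z w : ℍ}
    (hz : (z : ℂ) ∈ D.disc (invLetter a)) (hw : (w : ℂ) ∈ D.disc b) :
    Real.exp (gromovProduct I z w) ≤ 108 * D.centre a.1 := by
  have ha := D.centre_pos a.1
  have hb := D.centre_pos b.1
  have h_conj : conj ((I : ℍ) : ℂ) = -Complex.I := by simp
  have h_pos (z : ℍ) : 0 < ‖(z : ℂ) + Complex.I‖ := by
    simpa only [h_conj, sub_neg_eq_add] using norm_pos_iff.2 (sub_conj_ne_zero I z)
  have h_le := im_mul_norm_sub_div_le_exp_neg_gromovProduct I z w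
  rw [h_conj, sub_neg_eq_add, sub_neg_eq_add, I_im, one_mul, Real.exp_neg] at h_le
  refine (inv_le_inv₀ (by positivity) (Real.exp_pos _)).1 (le_trans ?_ h_le)
  calc (108 * D.centre a.1)⁻¹
      = D.centre b.1 / 12 / (3 * D.centre a.1 * (3 * D.centre b.1)) := by field_simp; norm_num
    _ ≤ _ := by
      gcongr
      · exact mul_pos (h_pos z) (h_pos w)
      · exact centre_div_twelve_le_norm_sub hab hz hw
      · exact norm_add_I_le (a := invLetter a) hz
      · exact norm_add_I_le hw

theorem IsCoding.exists_dist_prefixIsom_le (h : D.IsCoding A X) {o : ℍ} {x : ℝ} (hx : X 0 = x)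
    {c : ℝ → ℍ} (hc : IsGeodesicRay o x c) (n : ℕ) : ∃ t, 0 ≤ t ∧
      dist (D.prefixIsom A (n + 1) I) (c t) ≤ 432 * Real.exp (dist o I) * D.centre (A n).1 := by
  have h_lim := h.tendsto_prefixIsom_inv (hx ▸ (tendsto_coe_nhdsInfty o x).comp hc.tendsto) (n + 1)
  obtain ⟨s, hs, hs2⟩ :=
    ((h_lim.eventually_mem (h.disc_mem_nhds (n + 1))).and (eventually_ge_atTop 2)).exists
  obtain ⟨t, ht, h_dist⟩ := hc.exists_dist_le (D.prefixIsom A (n + 1) I) hs2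
  refine ⟨t, ht, h_dist.trans ?_⟩
  set γ := D.prefixIsom A (n + 1)
  have h_gromov : gromovProduct (γ I) o (c s) ≤
      gromovProduct I (γ⁻¹ I) (γ⁻¹ (c s)) + dist o I := by
    rw [gromovProduct_apply_left, ← (γ⁻¹).dist_eq o I]
    exact gromovProduct_le_add_dist _ _ _ _
  calc 4 * Real.exp (gromovProduct (γ I) o (c s))
      ≤ 4 * Real.exp (gromovProduct I (γ⁻¹ I) (γ⁻¹ (c s)) + dist o I) := by gcongr
    _ ≤ 4 * (108 * D.centre (A n).1 * Real.exp (dist o I)) := by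
        rw [Real.exp_add]
        gcongr
        exact exp_gromovProduct_le (h.nonCancelling n)
          (prefixIsom_succ_inv_I_mem_disc h.nonCancelling n) hs
    _ = _ := by ring

theorem IsCoding.tendsto_fst_cofinite (h : D.IsCoding A X) {o : ℍ} {x : ℝ} (hx : X 0 = x)
    {c : ℝ → ℍ} (hc : IsGeodesicRay o x c)
    (h_away : Tendsto (fun t => Metric.infDist (c t) (orbit D.group o)) atTop atTop) :
    Tendsto (fun n => (A n).1) atTop cofinite := by
  rw [Tendsto, le_cofinite_iff_eventually_ne]
  intro i
  have h_far := hc.eventually_forall_lt_dist h_away (fun n => D.prefixIsom_mem_group A (n + 1))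
    (tendsto_dist_prefixIsom_succ h.nonCancelling o) (432 * Real.exp (dist o I) * D.centre i)
  rw [eventually_map]
  filter_upwards [h_far] with n hn
  rintro rfl
  obtain ⟨t, ht, h_le⟩ := h.exists_dist_prefixIsom_le hx hc n
  exact (hn t ht).not_ge h_le

end Transience

end SchottkySystem

/-! ### Dimension of the limit sets -/

namespace SchottkySystem

variable {ι : Type*} {D : SchottkySystem ι}

section Dimension

open scoped NNReal

theorem exists_isCoding_of_mem_limitSet {o : ℍ} {x : ℝ}
    (hx : (x : OnePoint ℝ) ∈ limitSet D.group o) (hx' : (x : ℂ) ∉ D.exceptionalSet) :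
    ∃ A X, D.IsCoding A X ∧ X 0 = x :=
  exists_isCoding
    (mem_closure_coe_orbit_of_mem_closure I (mem_closure_coe_orbit_of_mem_limitSet hx)) hx'

theorem tsum_ratio_rpow_ne_top {s : ℝ≥0} (h : ∑' i, ENNReal.ofReal (D.radius i) ^ (s : ℝ) ≠ ∞) :
    ∑' i, (D.ratio i : ℝ≥0∞) ^ (s : ℝ) ≠ ∞ := by
  refine ne_top_of_le_ne_top (ENNReal.mul_ne_top (a := ENNReal.ofReal (9 / 4) ^ (s : ℝ))
    (ENNReal.rpow_ne_top_of_nonneg s.coe_nonneg ENNReal.ofReal_ne_top) h) ?_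
  rw [← ENNReal.tsum_mul_left]
  refine ENNReal.tsum_le_tsum fun i => ?_
  rw [← ENNReal.mul_rpow_of_nonneg _ _ s.coe_nonneg, ← ENNReal.ofReal_mul (by norm_num),
    ← ENNReal.ofReal_coe_nnreal]
  exact ENNReal.rpow_le_rpow (ENNReal.ofReal_le_ofReal (D.ratio_le_mul_radius i)) s.coe_nonneg

variable [Countable ι]

theorem hausdorffDim_limitSet_le {s : ℝ≥0} (hs : 0 < s)
    (h_ratio : 2 * ∑' i, (D.ratio i : ℝ≥0∞) ^ (s : ℝ) ≤ 1)
    (h_radius : ∑' i, ENNReal.ofReal (D.radius i) ^ (s : ℝ) ≠ ∞) (o : ℍ) :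
    hausdorffDim o (limitSet D.group o) ≤ s := by
  have h_coded (x : ℝ) (hx : (x : OnePoint ℝ) ∈ limitSet D.group o) :
      (x : ℂ) ∈ D.exceptionalSet ∪ D.codedSet Set.univ 0 :=
    or_iff_not_imp_left.2 fun hx' =>
      let ⟨A, X, h, h0⟩ := exists_isCoding_of_mem_limitSet hx hx'
      ⟨A, X, h, h0, fun _ _ => Set.mem_univ _⟩
  refine (hausdorffDim_le_dimH h_coded).trans ?_
  rw [dimH_union, dimH_countable D.countable_exceptionalSet]
  refine max_le zero_le (dimH_codedSet_le hs ?_ h_radius 0)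
  rwa [tsum_univ fun i => (D.ratio i : ℝ≥0∞) ^ (s : ℝ)]

theorem hausdorffDim_transientLimitSet_le {s : ℝ≥0} (hs : 0 < s)
    (h : ∑' i, ENNReal.ofReal (D.radius i) ^ (s : ℝ) ≠ ∞) (o : ℍ) :
    hausdorffDim o (transientLimitSet D.group o) ≤ s := by
  obtain ⟨F, hF⟩ := ((ENNReal.tendsto_tsum_compl_atTop_zero
    (tsum_ratio_rpow_ne_top h)).eventually_le_const (u := 2⁻¹) (by simp)).exists
  have h_coded (x : ℝ) (hx : (x : OnePoint ℝ) ∈ transientLimitSet D.group o) :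
      (x : ℂ) ∈ D.exceptionalSet ∪ ⋃ N, D.codedSet {i | i ∉ F} N := by
    obtain ⟨hx_limit, c, hc, h_away⟩ := hx
    refine or_iff_not_imp_left.2 fun hx' => ?_
    obtain ⟨A, X, h_coding, h0⟩ := exists_isCoding_of_mem_limitSet hx_limit hx'
    obtain ⟨N, hN⟩ := eventually_atTop.1 ((h_coding.tendsto_fst_cofinite h0 hc h_away).eventually
      F.finite_toSet.eventually_cofinite_notMem)
    exact Set.mem_iUnion.2 ⟨N, A, X, h_coding, h0, hN⟩
  have h_tail : 2 * ∑' i : {i | i ∉ F}, (D.ratio i : ℝ≥0∞) ^ (s : ℝ) ≤ 1 :=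
    (mul_le_mul_right hF 2).trans_eq (ENNReal.mul_inv_cancel two_ne_zero ENNReal.ofNat_ne_top)
  refine (hausdorffDim_le_dimH h_coded).trans ?_
  rw [dimH_union, dimH_countable D.countable_exceptionalSet, dimH_iUnion]
  exact max_le zero_le (iSup_le fun N => dimH_codedSet_le hs h_tail h N)

theorem hausdorffDim_transientLimitSet_eq_zero
    (h : ∀ s : ℝ≥0, 0 < s → ∑' i, ENNReal.ofReal (D.radius i) ^ (s : ℝ) ≠ ∞) (o : ℍ) :
    hausdorffDim o (transientLimitSet D.group o) = 0 :=
  nonpos_iff_eq_zero.1 (ENNReal.le_of_forall_pos_le_add fun s hs _ => by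
    simpa using hausdorffDim_transientLimitSet_le hs (h s hs) o)

end Dimension

end SchottkySystem

/-! ### The sparse family of half-circles -/

section Sparse

open scoped NNReal

theorem one_le_fixPt (j : ℕ) : 1 ≤ fixPt j := one_le_pow₀ one_le_two

theorem radius_pos (j : ℕ) : 0 < radius j := by
  unfold radius
  positivity

theorem radius_eq (j : ℕ) : radius j = 1 / 4 * (1 / 2) ^ j := by
  rw [radius, pow_add, mul_inv, one_div_pow]
  norm_num
  ring

theorem radius_le (j : ℕ) : radius j ≤ 1 / 4 := by
  rw [radius_eq]
  exact mul_le_of_le_one_right (by norm_num) (pow_le_one₀ (by norm_num) (by norm_num))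

theorem centre_sq (j : ℕ) : centre j ^ 2 = fixPt j ^ 2 + radius j ^ 2 :=
  Real.sq_sqrt (by positivity)

theorem fixPt_lt_centre (j : ℕ) : fixPt j < centre j :=
  Real.lt_sqrt_of_sq_lt (lt_add_of_pos_right _ (pow_pos (radius_pos j) 2))

theorem centre_le_fixPt_add (j : ℕ) : centre j ≤ fixPt j + 1 / 32 := by
  have hx := one_le_fixPt j
  refine Real.sqrt_le_iff.2 ⟨by positivity, ?_⟩
  nlinarith [radius_le j, radius_pos j]

theorem two_mul_fixPt_le {i j : ℕ} (h : i < j) : 2 * fixPt i ≤ fixPt j := by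
  rw [fixPt, fixPt, ← pow_succ']
  exact pow_le_pow_right₀ one_le_two (Nat.pow_lt_pow_left h two_ne_zero)

theorem centre_div_three_add_le {i j : ℕ} (h : i < j) :
    centre j / 3 + 1 / 4 ≤ centre j - centre i := by
  linarith [centre_le_fixPt_add i, two_mul_fixPt_le h, fixPt_lt_centre j, one_le_fixPt i]

theorem max_centre_div_three_add_le_abs_sub {i j : ℕ} (h : i ≠ j) :
    max (centre i) (centre j) / 3 + 1 / 4 ≤ |centre i - centre j| := by
  wlog hij : i < j generalizing i j
  · rw [max_comm, abs_sub_comm]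
    exact this h.symm (h.lt_or_gt.resolve_left hij)
  have h_sep := centre_div_three_add_le hij
  have h_pos := (one_le_fixPt j).trans_lt (fixPt_lt_centre j)
  have h_le : centre i ≤ centre j := by linarith
  rwa [max_eq_right h_le, abs_sub_comm, abs_of_nonneg (sub_nonneg.2 h_le)]

/-- The half-circles of the theorem. -/
def sparseSystem : SchottkySystem ℕ where
  centre := centre
  radius := radius
  one_le_centre j := (one_le_fixPt j).trans (fixPt_lt_centre j).le
  radius_pos := radius_pos
  radius_le := radius_le
  separated _ _ := max_centre_div_three_add_le_abs_sub

/-- The half-circles of the theorem whose index is at least `k`. -/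
def sparseTail (k : ℕ) : SchottkySystem ℕ := sparseSystem.comap (addLeftEmbedding k)

theorem tailGroup_matrix_sparseSystem (k : ℕ) :
    tailGroup sparseSystem.matrix k = (sparseTail k).group := by
  refine congrArg Subgroup.closure (Set.ext fun f => ?_)
  constructor
  · rintro ⟨j, hj, rfl⟩
    exact ⟨j - k, by rw [← Nat.add_sub_of_le hj]; simp; rfl⟩
  · rintro ⟨i, rfl⟩
    exact ⟨k + i, Nat.le_add_right k i, rfl⟩

theorem pairsHalfCircles_sparseSystem (j : ℕ) :
    PairsHalfCircles j (sparseSystem.matrix j) where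
  fixed := sparseSystem.setOf_matrix_smul_eq (eq_sub_of_add_eq (centre_sq j).symm)
  circle := sparseSystem.generator_image_halfCircle j
  ext_int := sparseSystem.generator_image_halfCircleExt j

theorem ratio_sparseSystem_le (j : ℕ) :
    (sparseSystem.ratio j : ℝ≥0∞) ≤ 2⁻¹ ^ (2 * j * (j + 1)) := by
  have h_le : 3 * radius j / centre j ≤ 2⁻¹ ^ (j * (j + 1)) :=
    calc 3 * radius j / centre j ≤ 4 * radius j / fixPt j := by
          have := one_le_fixPt j
          have := radius_pos j
          gcongr
          · norm_num
          · exact (fixPt_lt_centre j).le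
      _ = 2⁻¹ ^ (j * (j + 1)) := by
          rw [radius_eq, fixPt, one_div, div_eq_mul_inv (_ * _), ← inv_pow]
          ring
  have h_sq : sparseSystem.ratio j ≤ 2⁻¹ ^ (2 * j * (j + 1)) := by
    rw [← NNReal.coe_le_coe, SchottkySystem.coe_ratio, mul_assoc, mul_comm 2, pow_mul]
    push_cast
    exact pow_le_pow_left₀ (div_nonneg (mul_nonneg zero_le_three (radius_pos j).le)
      (Real.sqrt_nonneg _)) h_le 2
  rw [← ENNReal.coe_ofNat, ← ENNReal.coe_inv two_ne_zero, ← ENNReal.coe_pow]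
  exact ENNReal.coe_le_coe.2 h_sq

theorem ratio_sparseTail_rpow_le {k : ℕ} (hk : 1 ≤ k) (i : ℕ) :
    ((sparseTail k).ratio i : ℝ≥0∞) ^ (2 * k : ℝ)⁻¹ ≤ 2⁻¹ * 2⁻¹ ^ (i + 1) := by
  have h_exponent : (i + 2) * (2 * k) ≤ 2 * (k + i) * (k + i + 1) := by nlinarith
  rw [ENNReal.rpow_inv_le_iff (by positivity), ← pow_succ']
  calc ((sparseTail k).ratio i : ℝ≥0∞) ≤ 2⁻¹ ^ (2 * (k + i) * (k + i + 1)) :=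
        ratio_sparseSystem_le (k + i)
    _ ≤ 2⁻¹ ^ ((i + 2) * (2 * k)) := pow_le_pow_right_of_le_one' (by simp) h_exponent
    _ = (2⁻¹ ^ (i + 2)) ^ (2 * k : ℝ) := by
      rw [pow_mul, ← ENNReal.rpow_natCast _ (2 * k)]
      push_cast
      rfl

theorem two_mul_tsum_ratio_sparseTail_le {k : ℕ} (hk : 1 ≤ k) :
    2 * ∑' i, ((sparseTail k).ratio i : ℝ≥0∞) ^ (2 * k : ℝ)⁻¹ ≤ 1 :=
  calc _ ≤ 2 * ∑' i : ℕ, (2⁻¹ : ℝ≥0∞) * 2⁻¹ ^ (i + 1) := by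
        gcongr with i
        exact ratio_sparseTail_rpow_le hk i
    _ = 1 := by
        rw [ENNReal.tsum_mul_left, ← mul_assoc,
          ENNReal.mul_inv_cancel two_ne_zero ENNReal.ofNat_ne_top, one_mul,
          ENNReal.tsum_geometric_add_one, ENNReal.one_sub_inv_two, inv_inv,
          ENNReal.inv_mul_cancel two_ne_zero ENNReal.ofNat_ne_top]

theorem tsum_radius_sparseTail_ne_top (k : ℕ) {s : ℝ≥0} (hs : 0 < s) :
    ∑' i, ENNReal.ofReal ((sparseTail k).radius i) ^ (s : ℝ) ≠ ∞ := by
  have h_radius (i : ℕ) : ENNReal.ofReal ((sparseTail k).radius i) ≤ 2⁻¹ ^ i := by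
    rw [← ENNReal.ofReal_ofNat 2, ← ENNReal.ofReal_inv_of_pos two_pos,
      ← ENNReal.ofReal_pow (by norm_num)]
    refine ENNReal.ofReal_le_ofReal ?_
    calc radius (k + i) = (1 / 4 * (1 / 2) ^ k) * 2⁻¹ ^ i := by rw [radius_eq, pow_add]; ring
      _ ≤ 1 * 2⁻¹ ^ i := by
        gcongr
        exact mul_le_one₀ (by norm_num) (by positivity) (pow_le_one₀ (by norm_num) (by norm_num))
      _ = 2⁻¹ ^ i := one_mul _
  have h_lt : (2⁻¹ : ℝ≥0∞) ^ (s : ℝ) < 1 := ENNReal.rpow_lt_one (by simp) hs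
  refine ne_top_of_le_ne_top (b := ∑' i : ℕ, ((2⁻¹ : ℝ≥0∞) ^ (s : ℝ)) ^ i) ?_
    (ENNReal.tsum_le_tsum fun i => ?_)
  · rw [ENNReal.tsum_geometric]
    exact ENNReal.inv_ne_top.2 (tsub_pos_of_lt h_lt).ne'
  · rw [← ENNReal.rpow_natCast, ← ENNReal.rpow_mul, mul_comm, ENNReal.rpow_mul,
      ENNReal.rpow_natCast]
    exact ENNReal.rpow_le_rpow (h_radius i) hs.le

theorem hausdorffDim_limitSet_sparseTail_le {k : ℕ} (hk : 1 ≤ k) (o : ℍ) :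
    hausdorffDim o (limitSet (sparseTail k).group o) ≤ 1 / (2 * (k : ℝ≥0∞)) := by
  have hs : 0 < (2 * k : ℝ≥0)⁻¹ := by positivity
  refine (SchottkySystem.hausdorffDim_limitSet_le hs
    (by simpa using two_mul_tsum_ratio_sparseTail_le hk)
    (tsum_radius_sparseTail_ne_top k hs) o).trans_eq ?_
  rw [one_div, ENNReal.coe_inv (by positivity)]
  push_cast
  rfl

end Sparse

end

end Fuchsian

theorem theorem2 :
    ∃ (Γ : Subgroup (ℍ ≃ᵢ ℍ)) (h : ℕ → SL(2, ℝ)),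
      -- the group
      Fuchsian.IsFuchsian Γ ∧
      Fuchsian.IsTorsionFree Γ ∧
      ¬ Γ.FG ∧
      -- its transient limit set, for every choice of the base point
      (∀ o : ℍ, Fuchsian.hausdorffDim o (Fuchsian.transientLimitSet Γ o) = 0) ∧
      -- its construction
      (∀ j : ℕ, 1 ≤ j → Fuchsian.PairsHalfCircles j (h j)) ∧
      Γ = Fuchsian.tailGroup h 1 ∧
      -- the limit sets of the subgroups generated by `h k, h (k + 1), …`
      (∀ k : ℕ, 1 ≤ k → ∀ o : ℍ,
        Fuchsian.hausdorffDim o (Fuchsian.limitSet (Fuchsian.tailGroup h k) o)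
          ≤ 1 / (2 * (k : ℝ≥0∞))) := by
  refine ⟨(Fuchsian.sparseTail 1).group, Fuchsian.sparseSystem.matrix,
    (Fuchsian.sparseTail 1).isFuchsian_group, (Fuchsian.sparseTail 1).isTorsionFree_group,
    (Fuchsian.sparseTail 1).not_fg_group, ?_,
    fun j _ => Fuchsian.pairsHalfCircles_sparseSystem j,
    (Fuchsian.tailGroup_matrix_sparseSystem 1).symm, fun k hk o => ?_⟩
  · exact Fuchsian.SchottkySystem.hausdorffDim_transientLimitSet_eq_zero fun s hs =>
      Fuchsian.tsum_radius_sparseTail_ne_top 1 hs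
  · rw [Fuchsian.tailGroup_matrix_sparseSystem]
    exact Fuchsian.hausdorffDim_limitSet_sparseTail_le hk o
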